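/- Let $\phi,a$ be real numbers with $\cos\phi\neq0$, $a\neq0$, and let $\alpha>0$. Plane curves $r$ are parametrized by their angle of inclination $\theta\in\mathbb R$: $r'(\theta)=R(\theta)\,(\cos\theta,\sin\theta)$, where the signed radius of curvature $R:\mathbb R\to\mathbb R$ is smooth and may vanish (cusps); $R=R(\theta)$ is the inclination equation of the curve. The skew-evolute of the curve with tilting angle $\phi$ is the caustic (envelope) of the rays through $r(\theta)$ in the direction $\sin\phi\,T+\cos\phi\,N$, where $T=(\cos\theta,\sin\theta)$ and $N=(-\sin\theta,\cos\theta)$. Let $\theta_1=\theta+\frac\pi2-\phi$ be its angle of inclination and $R_1(\theta_1)$ its inclination equation. The curve is similar to its skew-evolute with factor $a$ and delay $\alpha$ if $R_1(\theta_1)=aR(\theta_1-\beta)$ for all $\theta_1$, where $\beta=\alpha+\frac\pi2-\phi$, so that $\theta_1-\beta=\theta-\alpha$. Put $$w=\frac{\alpha a}{\cos\phi}\,e^{\alpha\tan\phi},\qquad \lambda_k=\xi_k+i\eta_k=\frac1\alpha W_k(w)-\tan\phi\qquad(k\in\mathbb Z),$$ where $W_k$ is the $k$-th branch of the Lambert function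 (the inverse of $z\mapsto ze^z$). If $R$ is the inclination equation of a curve similar to its skew-evolute with factor $a$ and delay $\alpha$, then: (1) $R$ solves the delay differential equation $\cos\phi\,R'(\theta)+\sin\phi\,R(\theta)=a\,R(\theta-\alpha)$ for all $\theta\in\mathbb R$. (2) For $\lambda\in\mathbb C$ the function $e^{\lambda\theta}$ solves this equation if and only if $\lambda=\lambda_k$ for some $k\in\mathbb Z$. (3) There are real numbers $A_k,B_k$ $(k\ge0)$ and $A'$, with $A'=0$ unless $\lambda_{-1}$ is real, such that for every $\theta\in\mathbb R$ $$R(\theta)=A'\,m(\theta)+\sum_{k=0}^\infty e^{\xi_k\theta}\bigl(A_k\cos(\eta_k\theta)+B_k\sin(\eta_k\theta)\bigr),$$ where the series converges absolutely, and $m(\theta)=e^{\lambda_{-1}\theta}$ if $w\neq-\frac1e$, $m(\theta)=\theta e^{\lambda_{-1}\theta}$ if $w=-\frac1e$ (when $\lambda_{-1}=\lambda_0$ is a double root). -/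

import Mathlib

open scoped ContDiff

noncomputable section

/-! ### Plane curves through their angle of inclination

The Euclidean plane is `ℂ`, and the unit vector at angle `θ` to the `x`-axis is `exp (θ i)`. -/

/-- The unit tangent `T(θ) = (cos θ, sin θ)` at angle of inclination `θ`. -/
def unitTangent (θ : ℝ) : ℂ := Complex.exp (θ * Complex.I)

/-- The unit normal `N(θ) = (-sin θ, cos θ)`: the tangent turned counterclockwise by `90°`. -/
def unitNormal (θ : ℝ) : ℂ := Complex.I * unitTangent θ

/-- `R` is the inclination equation of the curve `γ`, given that `ϑ u` is the angle of inclination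
of `γ` at the parameter value `u`: the signed radius of curvature at the point of inclination `ϑ`
is `R ϑ`, that is, `dγ = T(ϑ) ds` with `ds = R(ϑ) dϑ`. Zeros of `R` are the cusps. -/
def HasInclinationEquation (γ : ℝ → ℂ) (ϑ R : ℝ → ℝ) : Prop :=
  ContDiff ℝ ∞ R ∧
    ∀ u : ℝ, HasDerivAt γ (((R (ϑ u) * deriv ϑ u : ℝ) : ℂ) * unitTangent (ϑ u)) u

/-- The cross product of two plane vectors. -/
def planeCross (v w : ℂ) : ℝ := v.re * w.im - v.im * w.re

/-- `c` is the caustic (envelope) of the family of rays through the points `r θ` in the directions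
`ν θ`: the point `c θ` lies on the ray number `θ`, and there the direction of moving transversally
to the rays is collinear with the ray. -/
def IsCaustic (r ν c : ℝ → ℂ) : Prop :=
  ∀ θ : ℝ, ∃ t : ℝ, c θ = r θ + t * ν θ ∧ planeCross (deriv r θ + t * deriv ν θ) (ν θ) = 0

/-- The direction of the ray tilted by the constant angle `φ` from the normal towards the tangent,
at the point of inclination `θ`. -/
def tiltedRay (φ θ : ℝ) : ℂ :=
  (Real.sin φ : ℂ) * unitTangent θ + (Real.cos φ : ℂ) * unitNormal θ

/-- `c` is the skew-evolute, with tilting angle `φ`, of the curve `r`, where `r` is parametrized by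
its angle of inclination. -/
def IsSkewEvolute (φ : ℝ) (r c : ℝ → ℂ) : Prop := IsCaustic r (tiltedRay φ) c

/-- `R` is the inclination equation of a plane curve `r` that is similar, with factor `a`, to its
skew-evolute `c` with tilting angle `φ`, with delay `α`. The angle of inclination of the
skew-evolute at the point of tangency with the ray is that of the ray, `θ₁ = θ + π/2 - φ`; the
curves are similar when their inclination equations `R₁` and `R` satisfy `R₁(θ₁) = a R(θ₁ - β)`;
and `θ₁ - β = θ - α`. -/
def SimilarToSkewEvoluteWithDelay (φ a α : ℝ) (R : ℝ → ℝ) : Prop :=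
  0 < α ∧ ∃ (r c : ℝ → ℂ) (R₁ : ℝ → ℝ) (β : ℝ),
    HasInclinationEquation r (fun θ => θ) R ∧
    IsSkewEvolute φ r c ∧
    HasInclinationEquation c (fun θ => θ + Real.pi / 2 - φ) R₁ ∧
    (∀ θ₁ : ℝ, R₁ θ₁ = a * R (θ₁ - β)) ∧
    α = β + φ - Real.pi / 2

/-! ### The Lambert function -/

/-- The range of the branch `W_k` of the Lambert function: where `z + log z` has its imaginary part
in `((2k-1)π, (2k+1)π]`, except that the real ray below `-1` belongs to `W_{-1}` and not to `W_0`.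
The branch point value `-1` is taken by both of these branches. The boundaries of these regions
are the curves `{-η cot η + iη}` and the ray `(-∞, -1]`. -/
def lambertRange (k : ℤ) : Set ℂ :=
  {z | (¬ (z.im = 0 ∧ z.re < -1) ∧
        (2 * (k : ℝ) - 1) * Real.pi < z.im + z.arg ∧
        z.im + z.arg ≤ (2 * (k : ℝ) + 1) * Real.pi) ∨
      (k = -1 ∧ z.im = 0 ∧ z.re ≤ -1)}

/-- The branch `W_k` of the Lambert function: `W_k(w)` is the solution of `z e^z = w` in the range
of the branch (a junk value only at `w = 0` for `k ≠ 0`, where `W_k` has its singularity). -/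
def lambertW (k : ℤ) (w : ℂ) : ℂ :=
  Classical.epsilon (fun z => z ∈ lambertRange k ∧ z * Complex.exp z = w)

/-- The argument `(α a / cos φ) e^{α tan φ}` of the Lambert function. -/
def lambertArg (φ a α : ℝ) : ℝ :=
  α * a / Real.cos φ * Real.exp (α * Real.tan φ)

/-- The exponents `λ_k = W_k((α a / cos φ) e^{α tan φ}) / α - tan φ`. -/
def skewExponent (φ a α : ℝ) (k : ℤ) : ℂ :=
  lambertW k (lambertArg φ a α : ℂ) / (α : ℂ) - (Real.tan φ : ℂ)

/-- The real mode of the exponent `ξ + iη` with coefficients `A`, `B`: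
`e^{ξθ} (A cos ηθ + B sin ηθ)`; it is `A e^{ξθ}` when the exponent is real. -/
def realMode (μ : ℂ) (A B θ : ℝ) : ℝ :=
  Real.exp (μ.re * θ) * (A * Real.cos (μ.im * θ) + B * Real.sin (μ.im * θ))

/-- The mode of a second real exponent `λ_{-1}`: `e^{λ_{-1} θ}`, or `θ e^{λ_{-1} θ}` when
`λ_{-1} = λ_0` is a double root, which happens at the branch point `-1/e` of the Lambert
function. -/
def secondRealMode (φ a α θ : ℝ) : ℝ :=
  if lambertArg φ a α = -Real.exp (-1) then θ * Real.exp ((skewExponent φ a α (-1)).re * θ)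
  else Real.exp ((skewExponent φ a α (-1)).re * θ)

end

/-! The envelope condition places the skew-evolute at `r + R cos φ ν`, where `ν` is the ray
direction. Differentiating and comparing the components along `ν` gives the delay equation
(`delay_equation_of_similar`). Inserting `e^{μθ}` and putting `z = α (μ + tan φ)` turns it into `z
e^z = w`, whose roots are the values `W_k(w)`.

For the expansion, `g(s) = e^{α s tan φ} R(α s)` solves `g'(s) = w g(s - 1)`. Write `D(μ) = μ e^μ -
w` and let `Q = delayTransform w g`, an entire function bounded by a multiple of `max(1, e^{Re μ})`.
The transform of `e^{zs}` for a root `z` is `D(μ)/(μ - z)`, which vanishes at every other root and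
equals `D'(z)` at `z`; this dictates the coefficient `Q(z)/D'(z)`. At a root, differentiating `g`
multiplies `Q` by `z`, so smoothness makes the coefficients decay fast enough for the series of
transforms to converge (`summable_modeCoeff`).

The difference between `Q` and that series vanishes at all roots with multiplicity. Its quotient by
`D` is entire and bounded on large squares, hence constant by Liouville, and the constant is `0`
because `D(x)` outgrows `e^x` on the positive axis (`eq_zero_of_norm_le_max_one_exp`). Since `e^{-x}
Q(x)` tends to `g(0)` at `+∞`, `g(0)` is the sum of the coefficients (`hasSum_modeCoeff`).
Translating by `s` multiplies each coefficient by `e^{zs}`, which gives the expansion at every `s`.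
A multiple root occurs only at `-1`, for `w = -1/e`; there suitable multiples of `e^{-s}` and `s
e^{-s}` are subtracted beforehand.

That each branch carries exactly one root follows from the monotonicity of `log |z e^z|` along the
curves `Im z + arg z = (m + 1) π` (`strictMonoOn_branchLog`). Finally conjugate roots are paired
into real modes; a real `W_{-1}` has no partner and yields the extra term. -/

/-! ### The characteristic function `μ e^μ - w` -/

/-- The characteristic function of the delay equation `g'(s) = w g(s - 1)`, times `e^μ`. -/
noncomputable def lambertChar (w : ℝ) (μ : ℂ) : ℂ := μ * Complex.exp μ - w

lemma lambertChar_eq_zero_iff {w : ℝ} {z : ℂ} :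
    lambertChar w z = 0 ↔ z * Complex.exp z = w := sub_eq_zero

lemma hasDerivAt_lambertChar (w : ℝ) (z : ℂ) :
    HasDerivAt (lambertChar w) ((1 + z) * Complex.exp z) z := by
  have h := ((hasDerivAt_id z).mul (Complex.hasDerivAt_exp z)).sub_const (w : ℂ)
  refine h.congr_deriv ?_
  simp only [id]
  ring

lemma differentiable_lambertChar (w : ℝ) : Differentiable ℂ (lambertChar w) :=
  fun z => (hasDerivAt_lambertChar w z).differentiableAt

lemma deriv_lambertChar (w : ℝ) :
    deriv (lambertChar w) = fun z => (1 + z) * Complex.exp z :=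
  funext fun z => (hasDerivAt_lambertChar w z).deriv

/-- The first derivative `(1 + z) e^z` vanishes only at `-1`, and there the second is `e^{-1}`; so
roots are simple except possibly a double one at `-1`. -/
lemma deriv_deriv_lambertChar_neg_one (w : ℝ) :
    deriv (deriv (lambertChar w)) (-1) ≠ 0 := by
  rw [deriv_lambertChar]
  have h := ((hasDerivAt_id (-1 : ℂ)).const_add 1).mul (Complex.hasDerivAt_exp (-1))
  have h2 : HasDerivAt (fun z : ℂ => (1 + z) * Complex.exp z) (Complex.exp (-1)) (-1) := by
    refine h.congr_deriv ?_
    simp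
  rw [h2.deriv]
  exact Complex.exp_ne_zero _

lemma analyticOrderAt_lambertChar_le_one {w : ℝ} {z : ℂ} (hz : z ≠ -1) :
    analyticOrderAt (lambertChar w) z ≤ 1 := by
  by_contra! h
  have h2 : ((2 : ℕ) : ℕ∞) ≤ analyticOrderAt (lambertChar w) z := by
    simpa [one_add_one_eq_two] using Order.add_one_le_of_lt h
  rw [natCast_le_analyticOrderAt_iff_iteratedDeriv_eq_zero
    ((differentiable_lambertChar w).analyticAt z)] at h2
  have h3 := h2 1 (by norm_num)
  rw [iteratedDeriv_one, deriv_lambertChar] at h3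
  rcases mul_eq_zero.1 h3 with h4 | h4
  · exact hz (eq_neg_of_add_eq_zero_right h4)
  · exact Complex.exp_ne_zero _ h4

lemma analyticOrderAt_lambertChar_neg_one_le_two (w : ℝ) :
    analyticOrderAt (lambertChar w) (-1) ≤ 2 := by
  by_contra! h
  have h2 : ((3 : ℕ) : ℕ∞) ≤ analyticOrderAt (lambertChar w) (-1) := by
    have := Order.add_one_le_of_lt h
    norm_num at this ⊢
    exact this
  rw [natCast_le_analyticOrderAt_iff_iteratedDeriv_eq_zero
    ((differentiable_lambertChar w).analyticAt _)] at h2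
  have h3 := h2 2 (by norm_num)
  rw [iteratedDeriv_succ, iteratedDeriv_one] at h3
  exact deriv_deriv_lambertChar_neg_one w h3

/-- The zeros of an entire function `T` cancel those of the characteristic function. -/
lemma analyticOrderAt_lambertChar_le {w : ℝ} {T : ℂ → ℂ} (hT : Differentiable ℂ T)
    (h0 : ∀ z, lambertChar w z = 0 → T z = 0)
    (h1 : lambertChar w (-1) = 0 → deriv T (-1) = 0) (z : ℂ) :
    analyticOrderAt (lambertChar w) z ≤ analyticOrderAt T z := by
  by_cases hz : lambertChar w z = 0
  · by_cases hz1 : z = -1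
    · subst hz1
      refine (analyticOrderAt_lambertChar_neg_one_le_two w).trans ?_
      have : ((2 : ℕ) : ℕ∞) ≤ analyticOrderAt T (-1) := by
        rw [natCast_le_analyticOrderAt_iff_iteratedDeriv_eq_zero (hT.analyticAt _)]
        intro i hi
        interval_cases i
        · simpa using h0 _ hz
        · simpa [iteratedDeriv_one] using h1 hz
      exact_mod_cast this
    · refine (analyticOrderAt_lambertChar_le_one hz1).trans ?_
      have : ((1 : ℕ) : ℕ∞) ≤ analyticOrderAt T z := by
        rw [natCast_le_analyticOrderAt_iff_iteratedDeriv_eq_zero (hT.analyticAt _)]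
        intro i hi
        interval_cases i
        simpa using h0 _ hz
      exact_mod_cast this
  · have : analyticOrderAt (lambertChar w) z = 0 := analyticOrderAt_eq_zero.2 (Or.inr hz)
    rw [this]
    exact bot_le

/-- Division of entire functions. -/
lemma exists_entire_quotient {f d : ℂ → ℂ} (hf : Differentiable ℂ f) (hd : Differentiable ℂ d)
    (htop : ∀ z, analyticOrderAt d z ≠ ⊤)
    (h : ∀ z, analyticOrderAt d z ≤ analyticOrderAt f z) :
    ∃ E : ℂ → ℂ, Differentiable ℂ E ∧ ∀ z, f z = d z * E z := by
  have hm : MeromorphicOn (f / d) Set.univ := fun z _ =>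
    (hf.analyticAt z).meromorphicAt.div (hd.analyticAt z).meromorphicAt
  -- The normal form of the quotient fills in the removable singularities: its order at every point
  -- is a difference of orders, nonnegative by `h`.
  have hE : Differentiable ℂ (toMeromorphicNFOn (f / d) Set.univ) := by
    intro z
    have hz := meromorphicNFOn_toMeromorphicNFOn (f / d) Set.univ (Set.mem_univ z)
    refine (hz.meromorphicOrderAt_nonneg_iff_analyticAt.1 ?_).differentiableAt
    rw [meromorphicOrderAt_toMeromorphicNFOn hm (Set.mem_univ z),
      meromorphicOrderAt_div (hf.analyticAt z).meromorphicAt (hd.analyticAt z).meromorphicAt,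
      (hf.analyticAt z).meromorphicOrderAt_eq, (hd.analyticAt z).meromorphicOrderAt_eq]
    have h1 := htop z
    have h2 := h z
    generalize analyticOrderAt d z = m at *
    generalize analyticOrderAt f z = n at *
    lift m to ℕ using h1
    induction n using ENat.recTopCoe with
    | top => exact le_top
    | coe n =>
      have h3 : m ≤ n := by exact_mod_cast h2
      have : (0 : ℤ) ≤ (n : ℤ) - (m : ℤ) := by lia
      rw [ENat.map_natCast, ENat.map_natCast]
      exact (WithTop.coe_le_coe.2 this).trans_eq (WithTop.LinearOrderedAddCommGroup.coe_sub _ _)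
  refine ⟨_, hE, fun z => ?_⟩
  -- The zeros of `d` are isolated, so the factorization holds on a punctured neighbourhood and
  -- passes to `z` by continuity.
  have hev : ∀ᶠ x in nhdsWithin z {z}ᶜ,
      f x = d x * toMeromorphicNFOn (f / d) Set.univ x := by
    have hne : ∀ᶠ x in nhdsWithin z {z}ᶜ, d x ≠ 0 := by
      rcases (hd.analyticAt z).eventually_eq_zero_or_eventually_ne_zero with h0 | h0
      · exact absurd (analyticOrderAt_eq_top.2 h0) (htop z)
      · exact h0
    filter_upwards [hne, hm.toMeromorphicNFOn_eq_self_on_nhdsNE (Set.mem_univ z)] with x h1 h2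
    rw [h2, Pi.div_apply, mul_div_cancel₀ _ h1]
  have h1 : Filter.Tendsto f (nhdsWithin z {z}ᶜ) (nhds (f z)) :=
    (hf z).continuousAt.tendsto.mono_left nhdsWithin_le_nhds
  have h2 := ((hd z).continuousAt.mul (hE z).continuousAt).tendsto.mono_left
    (nhdsWithin_le_nhds (s := {z}ᶜ))
  exact tendsto_nhds_unique_of_eventuallyEq h1 h2 hev

/-! ### Lower bounds for the characteristic function on large squares. -/

lemma norm_mul_exp (z : ℂ) : ‖z * Complex.exp z‖ = ‖z‖ * Real.exp z.re := by
  rw [norm_mul, Complex.norm_exp]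

/-- Lower bound on the horizontal sides of the squares. -/
lemma le_norm_lambertChar_of_im {w Y : ℝ} (hY : 1 ≤ Y) (hc : Real.cos Y = 0)
    (hs : w * Real.sin Y = |w|) (hs1 : |Real.sin Y| = 1) {z : ℂ} (hz : z.im = Y ∨ z.im = -Y) :
    min 1 |w| / 2 * max 1 (Real.exp z.re) ≤ ‖lambertChar w z‖ := by
  have hre : (lambertChar w z).re = -(Y * Real.sin Y * Real.exp z.re) - w := by
    unfold lambertChar
    rw [Complex.sub_re, Complex.mul_re, Complex.exp_re, Complex.exp_im, Complex.ofReal_re]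
    rcases hz with h | h <;> rw [h] <;> simp [hc] <;> ring
  have hw : w = |w| * Real.sin Y := by
    rw [← hs, mul_assoc, ← pow_two, ← sq_abs, hs1]
    ring
  -- The condition `w sin Y = |w|` gives the two terms of the real part the same sign, so they
  -- cannot cancel.
  have habs : |(lambertChar w z).re| = Y * Real.exp z.re + |w| := by
    rw [hre]
    have : -(Y * Real.sin Y * Real.exp z.re) - w
        = -((Y * Real.exp z.re + |w|) * Real.sin Y) := by
      nth_rewrite 1 [hw]
      ring
    rw [this, abs_neg, abs_mul, hs1, mul_one, abs_of_nonneg]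
    positivity
  refine le_trans ?_ (Complex.abs_re_le_norm _)
  rw [habs]
  have he := Real.exp_pos z.re
  have h1 : min 1 |w| ≤ 1 := min_le_left _ _
  have h2 : min 1 |w| ≤ |w| := min_le_right _ _
  have h0 : 0 ≤ min 1 |w| := le_min zero_le_one (abs_nonneg _)
  rcases le_total 1 (Real.exp z.re) with h | h
  · rw [max_eq_right h]
    nlinarith [abs_nonneg w]
  · rw [max_eq_left h]
    nlinarith [abs_nonneg w]

/-- On the right side of the square `|z e^z| ≥ Y e^Y` dominates `w`. -/
lemma le_norm_lambertChar_of_re_eq {w Y : ℝ} (hY : 1 + |w| ≤ Y) {z : ℂ} (hz : z.re = Y) :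
    min 1 |w| / 2 * max 1 (Real.exp z.re) ≤ ‖lambertChar w z‖ := by
  have hY0 : 0 ≤ Y := by linarith [abs_nonneg w]
  have h1 : Y * Real.exp Y ≤ ‖z * Complex.exp z‖ := by
    rw [norm_mul_exp, hz]
    have := Complex.abs_re_le_norm z
    rw [hz, abs_of_nonneg hY0] at this
    gcongr
  have h2 := norm_sub_norm_le (z * Complex.exp z) (w : ℂ)
  rw [Complex.norm_real, Real.norm_eq_abs] at h2
  have h3 : 1 ≤ Real.exp Y := Real.one_le_exp hY0
  have h4 : min 1 |w| ≤ 1 := min_le_left _ _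
  rw [hz, max_eq_right h3]
  unfold lambertChar
  nlinarith [abs_nonneg w]

/-- On the left side `z e^z` is at most `|w| / 2` in norm, so the constant `w` dominates. -/
lemma le_norm_lambertChar_of_re_eq_neg {w Y : ℝ} (hY0 : 0 ≤ Y)
    (hY : 2 * Y * Real.exp (-Y) ≤ |w| / 2) {z : ℂ} (hz : z.re = -Y) (hi : |z.im| ≤ Y) :
    min 1 |w| / 2 * max 1 (Real.exp z.re) ≤ ‖lambertChar w z‖ := by
  have h1 : ‖z * Complex.exp z‖ ≤ 2 * Y * Real.exp (-Y) := by
    rw [norm_mul_exp, hz]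
    have := Complex.norm_le_abs_re_add_abs_im z
    rw [hz, abs_neg, abs_of_nonneg hY0] at this
    gcongr
    linarith
  have h2 := norm_sub_norm_le (w : ℂ) (z * Complex.exp z)
  rw [Complex.norm_real, Real.norm_eq_abs, norm_sub_rev] at h2
  have h3 : Real.exp (-Y) ≤ 1 := Real.exp_le_one_iff.2 (by linarith)
  have h4 : min 1 |w| ≤ |w| := min_le_right _ _
  rw [hz, max_eq_left h3]
  unfold lambertChar
  linarith

/-- Arbitrarily large squares on which the characteristic function is bounded below. -/
lemma exists_large_square {w : ℝ} (hw : w ≠ 0) (M : ℝ) :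
    ∃ Y : ℝ, M ≤ Y ∧ 0 < Y ∧ ∀ z : ℂ, |z.re| ≤ Y → |z.im| ≤ Y → (|z.re| = Y ∨ |z.im| = Y) →
      min 1 |w| / 2 * max 1 (Real.exp z.re) ≤ ‖lambertChar w z‖ := by
  have hlim : Filter.Tendsto (fun Y : ℝ => 2 * (Y ^ 1 * Real.exp (-Y))) Filter.atTop (nhds 0) := by
    simpa using (Real.tendsto_pow_mul_exp_neg_atTop_nhds_zero 1).const_mul 2
  have hev : ∀ᶠ Y : ℝ in Filter.atTop, 2 * Y * Real.exp (-Y) ≤ |w| / 2 ∧ M ≤ Y ∧ 1 + |w| ≤ Y := by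
    filter_upwards [hlim.eventually_le_const (half_pos (abs_pos.2 hw)),
      Filter.eventually_ge_atTop M, Filter.eventually_ge_atTop (1 + |w|)] with Y h1 h2 h3
    refine ⟨?_, h2, h3⟩
    rw [pow_one] at h1
    linarith
  obtain ⟨Y₀, hY₀⟩ := Filter.eventually_atTop.1 hev
  -- `Y` is taken congruent to `π/2` or `-π/2` modulo `2π`, according to the sign of `w`.
  obtain ⟨Y, hYY, hc, hs, hs1⟩ : ∃ Y, Y₀ ≤ Y ∧ Real.cos Y = 0 ∧ w * Real.sin Y = |w| ∧
      |Real.sin Y| = 1 := by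
    obtain ⟨n, hn⟩ := exists_nat_ge (|Y₀| / (2 * Real.pi) + 1)
    have hpi := Real.pi_pos
    have hn' : |Y₀| ≤ (n - 1) * (2 * Real.pi) := by
      rw [← div_le_iff₀ (by positivity)]
      linarith
    have hle := le_abs_self Y₀
    rcases lt_or_gt_of_ne hw with h | h
    · refine ⟨-(Real.pi / 2) + n * (2 * Real.pi), by nlinarith, ?_, ?_, ?_⟩
      · rw [Real.cos_add_nat_mul_two_pi]; simp
      · rw [Real.sin_add_nat_mul_two_pi, abs_of_neg h]; simp
      · rw [Real.sin_add_nat_mul_two_pi]; simp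
    · refine ⟨Real.pi / 2 + n * (2 * Real.pi), by nlinarith, ?_, ?_, ?_⟩
      · rw [Real.cos_add_nat_mul_two_pi]; simp
      · rw [Real.sin_add_nat_mul_two_pi, abs_of_pos h]; simp
      · rw [Real.sin_add_nat_mul_two_pi]; simp
  obtain ⟨h1, h2, h3⟩ := hY₀ Y hYY
  have hY1 : 1 ≤ Y := by linarith [abs_nonneg w]
  refine ⟨Y, h2, by linarith, fun z _ hzi hz => ?_⟩
  rcases hz with hz | hz
  · rcases eq_or_eq_neg_of_abs_eq hz with h | h
    · exact le_norm_lambertChar_of_re_eq h3 h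
    · exact le_norm_lambertChar_of_re_eq_neg (by linarith) h1 h hzi
  · exact le_norm_lambertChar_of_im hY1 hc hs hs1 (eq_or_eq_neg_of_abs_eq hz)

/-- An entire function that is bounded by `max(1, e^{Re μ})` and divisible by the characteristic
function vanishes. -/
theorem eq_zero_of_norm_le_max_one_exp {w : ℝ} (hw : w ≠ 0) {T : ℂ → ℂ}
    (hT : Differentiable ℂ T) {C : ℝ} (hC : ∀ z, ‖T z‖ ≤ C * max 1 (Real.exp z.re))
    (h0 : ∀ z, lambertChar w z = 0 → T z = 0)
    (h1 : lambertChar w (-1) = 0 → deriv T (-1) = 0) (z : ℂ) : T z = 0 := by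
  obtain ⟨E, hE, hTE⟩ := exists_entire_quotient hT (differentiable_lambertChar w)
    (fun z => by
      by_cases hz : z = -1
      · subst hz
        exact ne_top_of_le_ne_top (by simp) (analyticOrderAt_lambertChar_neg_one_le_two w)
      · exact ne_top_of_le_ne_top (by simp) (analyticOrderAt_lambertChar_le_one hz))
    (analyticOrderAt_lambertChar_le hT h0 h1)
  have hmin : 0 < min 1 |w| / 2 := half_pos (lt_min one_pos (abs_pos.2 hw))
  have hbound : ∀ z, ‖E z‖ ≤ C / (min 1 |w| / 2) := by
    intro z
    obtain ⟨Y, hMY, hY0, hY⟩ := exists_large_square hw (‖z‖ + 1)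
    have hre : |z.re| < Y := by linarith [Complex.abs_re_le_norm z]
    have him : |z.im| < Y := by linarith [Complex.abs_im_le_norm z]
    have hne : -Y ≠ Y := by linarith
    have hU : Bornology.IsBounded (Set.Ioo (-Y) Y ×ℂ Set.Ioo (-Y) Y) :=
      (Metric.isBounded_Ioo _ _).reProdIm (Metric.isBounded_Ioo _ _)
    -- Maximum principle: on the boundary of the square the factor `max(1, e^{Re x})` cancels
    -- between the two bounds.
    refine Complex.norm_le_of_forall_mem_frontier_norm_le hU hE.diffContOnCl ?_
      (subset_closure ⟨abs_lt.1 hre, abs_lt.1 him⟩)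
    intro x hx
    have hx' : |x.re| ≤ Y ∧ |x.im| ≤ Y ∧ (|x.re| = Y ∨ |x.im| = Y) := by
      rw [Complex.frontier_reProdIm, closure_Ioo hne, frontier_Ioo (by linarith)] at hx
      rcases hx with ⟨h1, h2⟩ | ⟨h1, h2⟩
      · have : |x.im| = Y := by
          rcases h2 with h | h
          · rw [h, abs_neg, abs_of_pos hY0]
          · rw [h, abs_of_pos hY0]
        exact ⟨abs_le.2 h1, this.le, Or.inr this⟩
      · have : |x.re| = Y := by
          rcases h1 with h | h
          · rw [h, abs_neg, abs_of_pos hY0]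
          · rw [h, abs_of_pos hY0]
        exact ⟨this.le, abs_le.2 h2, Or.inl this⟩
    have hlow := hY x hx'.1 hx'.2.1 hx'.2.2
    have hup := hC x
    rw [hTE, norm_mul] at hup
    have hm : 0 < max 1 (Real.exp x.re) := lt_max_of_lt_left one_pos
    rw [le_div_iff₀ hmin]
    have := (mul_le_mul_of_nonneg_right hlow (norm_nonneg (E x))).trans hup
    refine le_of_mul_le_mul_right ?_ hm
    calc _ = min 1 |w| / 2 * max 1 (Real.exp x.re) * ‖E x‖ := by ring
      _ ≤ _ := this
  have hconst : ∀ z, E z = E 0 := fun z => hE.apply_eq_apply_of_bounded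
    (isBounded_iff_forall_norm_le.2 ⟨_, by rintro _ ⟨y, rfl⟩; exact hbound y⟩) z 0
  have hzero : E 0 = 0 := by
    by_contra hne
    have hpos : 0 < ‖E 0‖ := norm_pos_iff.2 hne
    -- Chosen so that `(x - |w|) ‖E 0‖ = |C| + ‖E 0‖`, which exceeds `C` and contradicts the growth
    -- bound at `x`.
    set x : ℝ := |w| + |C| / ‖E 0‖ + 1 with hx
    have hx0 : 0 < x := by positivity
    have h2 := hC x
    rw [hTE, norm_mul, hconst x, Complex.ofReal_re,
      max_eq_right (Real.one_le_exp hx0.le)] at h2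
    have h3 := norm_sub_norm_le ((x : ℂ) * Complex.exp x) (w : ℂ)
    rw [Complex.norm_real, Real.norm_eq_abs, norm_mul_exp, Complex.norm_real, Complex.ofReal_re,
      Real.norm_of_nonneg hx0.le] at h3
    have he : 1 ≤ Real.exp x := Real.one_le_exp hx0.le
    have h4 : (x - |w|) * Real.exp x ≤ ‖lambertChar w x‖ := by
      unfold lambertChar
      nlinarith [abs_nonneg w]
    have h5 := (mul_le_mul_of_nonneg_right h4 hpos.le).trans h2
    have h6 : (x - |w|) * ‖E 0‖ = |C| + ‖E 0‖ := by
      rw [hx]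
      field_simp
      ring
    have h7 : (|C| + ‖E 0‖) * Real.exp x ≤ C * Real.exp x := by
      rw [← h6]
      linarith
    have h8 := le_of_mul_le_mul_right h7 (Real.exp_pos x)
    linarith [le_abs_self C]
  rw [hTE, hconst, hzero, mul_zero]

/-! ### Smooth solutions of `g'(s) = w g(s - 1)` and their transform -/

/-- `g` is a smooth solution on the whole line of the delay equation `g'(s) = w g(s - 1)`. -/
def IsDelaySolution (w : ℝ) (g : ℝ → ℂ) : Prop :=
  ContDiff ℝ ∞ g ∧ ∀ s, deriv g s = w * g (s - 1)

/-- The numerator of the Laplace transform of a solution `g` of the delay equation, whose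
denominator is the characteristic function. -/
noncomputable def delayTransform (w : ℝ) (g : ℝ → ℂ) (μ : ℂ) : ℂ :=
  g 0 * Complex.exp μ + w * ∫ u in (0 : ℝ)..1, Complex.exp (μ * u) * g (-u)

lemma norm_exp_mul_le {μ : ℂ} {u : ℝ} (h0 : 0 ≤ u) (h1 : u ≤ 1) :
    ‖Complex.exp (μ * u)‖ ≤ max 1 (Real.exp μ.re) := by
  rw [Complex.norm_exp, Complex.re_mul_ofReal]
  rcases le_total 0 μ.re with h | h
  · exact le_max_of_le_right (Real.exp_le_exp.2 (mul_le_of_le_one_right h h1))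
  · exact le_max_of_le_left (Real.exp_le_one_iff.2 (mul_nonpos_of_nonpos_of_nonneg h h0))

lemma differentiable_delayTransform (w : ℝ) {g : ℝ → ℂ} (hg : Continuous g) :
    Differentiable ℂ (delayTransform w g) := by
  intro μ
  obtain ⟨M, hM⟩ := (isCompact_Icc (a := (0 : ℝ)) (b := 1)).exists_bound_of_continuousOn
    (f := fun u : ℝ => g (-u)) (by fun_prop)
  have hmain := intervalIntegral.hasDerivAt_integral_of_dominated_loc_of_deriv_le
    (μ := MeasureTheory.volume) (a := 0) (b := 1) (x₀ := μ) (s := Metric.ball μ 1)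
    (bound := fun _ => Real.exp (‖μ‖ + 1) * M)
    (F := fun μ u => Complex.exp (μ * u) * g (-u))
    (F' := fun μ u => u * Complex.exp (μ * u) * g (-u))
    (Metric.ball_mem_nhds μ one_pos)
    (Filter.Eventually.of_forall fun x =>
      Continuous.aestronglyMeasurable (by fun_prop))
    (Continuous.intervalIntegrable (by fun_prop) _ _)
    (Continuous.aestronglyMeasurable (by fun_prop))
    (by
      refine Filter.Eventually.of_forall fun u hu x hx => ?_
      rw [Set.uIoc_of_le zero_le_one] at hu
      have hM' := hM u ⟨hu.1.le, hu.2⟩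
      have h1 : ‖Complex.exp (x * u)‖ ≤ Real.exp (‖μ‖ + 1) := by
        refine (norm_exp_mul_le hu.1.le hu.2).trans (max_le (Real.one_le_exp (by positivity)) ?_)
        refine Real.exp_le_exp.2 ((Complex.re_le_norm x).trans ?_)
        rw [mem_ball_iff_norm] at hx
        linarith [norm_le_norm_add_norm_sub' x μ]
      have h2 : ‖(u : ℂ)‖ ≤ 1 := by
        rw [Complex.norm_real, Real.norm_of_nonneg hu.1.le]
        exact hu.2
      rw [norm_mul, norm_mul]
      calc ‖(u : ℂ)‖ * ‖Complex.exp (x * u)‖ * ‖g (-u)‖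
          ≤ 1 * Real.exp (‖μ‖ + 1) * M := by gcongr
        _ = _ := by ring)
    (by simp)
    (by
      refine Filter.Eventually.of_forall fun u _ x _ => ?_
      have := (((hasDerivAt_id x).mul_const (u : ℂ)).cexp).mul_const (g (-u))
      refine this.congr_deriv ?_
      simp only [id]
      ring)
  exact (((Complex.hasDerivAt_exp μ).const_mul (g 0)).add
    (hmain.2.const_mul (w : ℂ))).differentiableAt

lemma norm_delayTransform_le {w : ℝ} {g : ℝ → ℂ} {M : ℝ}
    (hM : ∀ u ∈ Set.Icc (0 : ℝ) 1, ‖g (-u)‖ ≤ M) (μ : ℂ) :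
    ‖delayTransform w g μ‖ ≤ (1 + |w|) * M * max 1 (Real.exp μ.re) := by
  have hM0 : 0 ≤ M := (norm_nonneg _).trans (hM 0 (by simp))
  have h1 : ‖∫ u in (0 : ℝ)..1, Complex.exp (μ * u) * g (-u)‖
      ≤ max 1 (Real.exp μ.re) * M * |1 - 0| := by
    refine intervalIntegral.norm_integral_le_of_norm_le_const fun u hu => ?_
    rw [Set.uIoc_of_le zero_le_one] at hu
    rw [norm_mul]
    have := hM u ⟨hu.1.le, hu.2⟩
    have := norm_exp_mul_le (μ := μ) hu.1.le hu.2
    gcongr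
  have h2 : ‖g 0‖ ≤ M := by simpa using hM 0 (by simp)
  have h3 : ‖Complex.exp μ‖ ≤ max 1 (Real.exp μ.re) := by
    rw [Complex.norm_exp]
    exact le_max_right _ _
  unfold delayTransform
  refine (norm_add_le _ _).trans ?_
  rw [norm_mul, norm_mul, Complex.norm_real, Real.norm_eq_abs]
  rw [sub_zero, abs_one, mul_one] at h1
  calc _ ≤ M * max 1 (Real.exp μ.re) + |w| * (max 1 (Real.exp μ.re) * M) := by gcongr
    _ = _ := by ring

lemma exists_norm_delayTransform_le (w : ℝ) {g : ℝ → ℂ} (hg : Continuous g) :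
    ∃ C, 0 ≤ C ∧ ∀ μ, ‖delayTransform w g μ‖ ≤ C * max 1 (Real.exp μ.re) := by
  obtain ⟨M, hM⟩ := (isCompact_Icc (a := (0 : ℝ)) (b := 1)).exists_bound_of_continuousOn
    (f := fun u : ℝ => g (-u)) (by fun_prop)
  have hM0 : 0 ≤ M := (norm_nonneg _).trans (hM 0 (by simp))
  exact ⟨(1 + |w|) * M, by positivity, norm_delayTransform_le hM⟩

/-- The transform recovers the value at `0`. -/
lemma tendsto_exp_neg_mul_delayTransform (w : ℝ) {g : ℝ → ℂ} (hg : Continuous g) :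
    Filter.Tendsto (fun x : ℝ => Complex.exp (-x) * delayTransform w g x) Filter.atTop
      (nhds (g 0)) := by
  obtain ⟨M, hM⟩ := (isCompact_Icc (a := (0 : ℝ)) (b := 1)).exists_bound_of_continuousOn
    (f := fun u : ℝ => g (-u)) (by fun_prop)
  have hM0 : 0 ≤ M := (norm_nonneg _).trans (hM 0 (by simp))
  have hlim : Filter.Tendsto (fun x : ℝ => |w| * M * x⁻¹) Filter.atTop (nhds 0) := by
    simpa using tendsto_inv_atTop_zero.const_mul (|w| * M)
  rw [tendsto_iff_norm_sub_tendsto_zero]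
  refine squeeze_zero' (Filter.Eventually.of_forall fun _ => norm_nonneg _) ?_ hlim
  filter_upwards [Filter.eventually_gt_atTop 0] with x hx
  have h1 : Complex.exp (-x) * delayTransform w g x - g 0 =
      Complex.exp (-x) * (w * ∫ u in (0 : ℝ)..1, Complex.exp (x * u) * g (-u)) := by
    unfold delayTransform
    have : Complex.exp (-x) * Complex.exp x = 1 := by rw [← Complex.exp_add]; simp
    linear_combination g 0 * this
  -- After multiplication by `e^{-x}` this majorant is at most `M / x`.
  have h2 : ‖∫ u in (0 : ℝ)..1, Complex.exp (x * u) * g (-u)‖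
      ≤ ∫ u in (0 : ℝ)..1, M * Real.exp (x * u) := by
    refine intervalIntegral.norm_integral_le_of_norm_le zero_le_one ?_
      (Continuous.intervalIntegrable (by fun_prop) _ _)
    refine Filter.Eventually.of_forall fun u hu => ?_
    rw [norm_mul, Complex.norm_exp, mul_comm]
    have := hM u ⟨hu.1.le, hu.2⟩
    simp only [Complex.re_mul_ofReal, Complex.ofReal_re]
    gcongr
  have h3 : ∫ u in (0 : ℝ)..1, M * Real.exp (x * u) = M * (x⁻¹ * (Real.exp x - 1)) := by
    rw [intervalIntegral.integral_const_mul, intervalIntegral.integral_comp_mul_left _ hx.ne']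
    simp
  rw [h1, norm_mul, norm_mul, Complex.norm_real, Real.norm_eq_abs, Complex.norm_exp]
  rw [h3] at h2
  have h4 : Real.exp (-x) * (Real.exp x - 1) ≤ 1 := by
    have : Real.exp (-x) * Real.exp x = 1 := by rw [← Real.exp_add]; simp
    rw [mul_sub, this]
    linarith [Real.exp_pos (-x)]
  simp only [Complex.neg_re, Complex.ofReal_re]
  calc Real.exp (-x) * (|w| * ‖∫ u in (0 : ℝ)..1, Complex.exp (x * u) * g (-u)‖)
      ≤ Real.exp (-x) * (|w| * (M * (x⁻¹ * (Real.exp x - 1)))) := by gcongr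
    _ = |w| * M * x⁻¹ * (Real.exp (-x) * (Real.exp x - 1)) := by ring
    _ ≤ |w| * M * x⁻¹ * 1 := by gcongr
    _ = _ := mul_one _

lemma delayTransform_sub (w : ℝ) {g h : ℝ → ℂ} (hg : Continuous g) (hh : Continuous h) (μ : ℂ) :
    delayTransform w (fun s => g s - h s) μ = delayTransform w g μ - delayTransform w h μ := by
  unfold delayTransform
  have : ∫ u in (0 : ℝ)..1, Complex.exp (μ * u) * (g (-u) - h (-u)) =
      (∫ u in (0 : ℝ)..1, Complex.exp (μ * u) * g (-u)) -
        ∫ u in (0 : ℝ)..1, Complex.exp (μ * u) * h (-u) := by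
    rw [← intervalIntegral.integral_sub (Continuous.intervalIntegrable (by fun_prop) _ _)
      (Continuous.intervalIntegrable (by fun_prop) _ _)]
    simp only [mul_sub]
  rw [this]
  ring

lemma delayTransform_const_mul (w : ℝ) (c : ℂ) (g : ℝ → ℂ) (μ : ℂ) :
    delayTransform w (fun s => c * g s) μ = c * delayTransform w g μ := by
  unfold delayTransform
  simp only [mul_left_comm _ c, intervalIntegral.integral_const_mul]
  ring

lemma IsDelaySolution.continuous {w : ℝ} {g : ℝ → ℂ} (hg : IsDelaySolution w g) :
    Continuous g := hg.1.continuous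

lemma IsDelaySolution.hasDerivAt {w : ℝ} {g : ℝ → ℂ} (hg : IsDelaySolution w g) (s : ℝ) :
    HasDerivAt g (w * g (s - 1)) s := by
  rw [← hg.2 s]
  exact (hg.1.differentiable (by simp) s).hasDerivAt

lemma IsDelaySolution.deriv {w : ℝ} {g : ℝ → ℂ} (hg : IsDelaySolution w g) :
    IsDelaySolution w (deriv g) := by
  have hd : ContDiff ℝ ∞ (_root_.deriv g) := (contDiff_infty_iff_deriv.1 hg.1).2
  refine ⟨hd, fun s => ?_⟩
  have h1 : _root_.deriv g = fun s => w * g (s - 1) := funext hg.2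
  have h2 := ((hg.hasDerivAt (s - 1)).comp_sub_const s 1).const_mul (w : ℂ)
  conv_lhs => rw [h1]
  rw [h2.deriv, hg.2]

lemma IsDelaySolution.comp_add_const {w : ℝ} {g : ℝ → ℂ} (hg : IsDelaySolution w g) (t : ℝ) :
    IsDelaySolution w (fun s => g (s + t)) := by
  refine ⟨hg.1.comp (contDiff_id.add contDiff_const), fun s => ?_⟩
  rw [deriv_comp_add_const, hg.2]
  congr 2
  ring

lemma IsDelaySolution.sub {w : ℝ} {g h : ℝ → ℂ} (hg : IsDelaySolution w g)
    (hh : IsDelaySolution w h) : IsDelaySolution w (fun s => g s - h s) := by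
  refine ⟨hg.1.sub hh.1, fun s => ?_⟩
  refine ((hg.hasDerivAt s).sub (hh.hasDerivAt s)).deriv.trans ?_
  ring

lemma IsDelaySolution.const_mul {w : ℝ} {g : ℝ → ℂ} (hg : IsDelaySolution w g) (c : ℂ) :
    IsDelaySolution w (fun s => c * g s) := by
  refine ⟨contDiff_const.mul hg.1, fun s => ?_⟩
  rw [((hg.hasDerivAt s).const_mul c).deriv]
  ring

/-! ### Exponential solutions, and the transforms of modes, derivatives and translates. -/

lemma hasDerivAt_exp_mul_ofReal (z : ℂ) (s : ℝ) :
    HasDerivAt (fun s : ℝ => Complex.exp (z * s)) (z * Complex.exp (z * s)) s := by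
  have h := (((hasDerivAt_id (s : ℂ)).const_mul z).cexp).comp_ofReal
  refine h.congr_deriv ?_
  simp only [id, mul_one]
  ring

lemma contDiff_exp_mul_ofReal (z : ℂ) : ContDiff ℝ ∞ (fun s : ℝ => Complex.exp (z * s)) :=
  (contDiff_const.mul Complex.ofRealCLM.contDiff).cexp

lemma isDelaySolution_exp {w : ℝ} {z : ℂ} (hz : lambertChar w z = 0) :
    IsDelaySolution w (fun s => Complex.exp (z * s)) := by
  refine ⟨contDiff_exp_mul_ofReal z, fun s => ?_⟩
  rw [(hasDerivAt_exp_mul_ofReal z s).deriv, ← lambertChar_eq_zero_iff.1 hz, mul_assoc,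
    ← Complex.exp_add]
  congr 2
  push_cast
  ring

/-- The second solution at the double root `-1`. -/
lemma isDelaySolution_mul_exp {w : ℝ} (hw : lambertChar w (-1) = 0) :
    IsDelaySolution w (fun s => s * Complex.exp (-1 * s)) := by
  refine ⟨Complex.ofRealCLM.contDiff.mul (contDiff_exp_mul_ofReal _), fun s => ?_⟩
  have h := (Complex.ofRealCLM.hasDerivAt (x := s)).mul (hasDerivAt_exp_mul_ofReal (-1) s)
  have h2 : HasDerivAt (fun s : ℝ => (s : ℂ) * Complex.exp (-1 * s))
      ((1 - s) * Complex.exp (-1 * s)) s := by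
    refine h.congr_deriv ?_
    simp only [Complex.ofRealCLM_apply, Complex.ofReal_one]
    ring
  rw [h2.deriv, ← lambertChar_eq_zero_iff.1 hw]
  have : Complex.exp (-1 * s) = Complex.exp (-1) * Complex.exp (-1 * ((s - 1 : ℝ) : ℂ)) := by
    rw [← Complex.exp_add]
    congr 1
    push_cast
    ring
  rw [this]
  push_cast
  ring

/-- The integral is elementary, and `w = z e^z` combines it with the boundary term. Dividing by `μ -
z` shows that the transform vanishes at every other root: the modes are biorthogonal to evaluation
at the roots. -/
lemma sub_mul_delayTransform_exp {w : ℝ} {z : ℂ} (hz : lambertChar w z = 0) (μ : ℂ) :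
    (μ - z) * delayTransform w (fun s => Complex.exp (z * s)) μ = lambertChar w μ := by
  have hint : (μ - z) * ∫ u in (0 : ℝ)..1, Complex.exp (μ * u) * Complex.exp (z * ((-u : ℝ) : ℂ))
      = Complex.exp (μ - z) - 1 := by
    rw [← intervalIntegral.integral_const_mul,
      intervalIntegral.integral_eq_sub_of_hasDerivAt
        (f := fun u : ℝ => Complex.exp ((μ - z) * u)) (fun u _ => ?_)
        (Continuous.intervalIntegrable (by fun_prop) _ _)]
    · simp
    · refine (hasDerivAt_exp_mul_ofReal (μ - z) u).congr_deriv ?_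
      rw [← Complex.exp_add]
      congr 2
      push_cast
      ring
  have hz' := lambertChar_eq_zero_iff.1 hz
  have he : Complex.exp z * Complex.exp (μ - z) = Complex.exp μ := by
    rw [← Complex.exp_add]
    congr 1
    ring
  unfold delayTransform lambertChar
  rw [mul_add, mul_left_comm _ (w : ℂ), hint]
  simp only [Complex.ofReal_zero, mul_zero, Complex.exp_zero, one_mul]
  rw [← hz']
  linear_combination z * he

lemma add_one_sq_mul_delayTransform_mul_exp {w : ℝ} (hw : lambertChar w (-1) = 0) (μ : ℂ) :
    (μ + 1) ^ 2 * delayTransform w (fun s => s * Complex.exp (-1 * s)) μ = lambertChar w μ := by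
  have hint : (μ + 1) ^ 2 * ∫ u in (0 : ℝ)..1,
      Complex.exp (μ * u) * (((-u : ℝ) : ℂ) * Complex.exp (-1 * ((-u : ℝ) : ℂ)))
      = -(μ * Complex.exp (μ + 1) + 1) := by
    rw [← intervalIntegral.integral_const_mul,
      intervalIntegral.integral_eq_sub_of_hasDerivAt
        (f := fun u : ℝ => -(((μ + 1) * u - 1) * Complex.exp ((μ + 1) * u))) (fun u _ => ?_)
        (Continuous.intervalIntegrable (by fun_prop) _ _)]
    · simp
      ring
    · have h1 := ((Complex.ofRealCLM.hasDerivAt (x := u)).const_mul (μ + 1)).sub_const 1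
      have h2 := (h1.mul (hasDerivAt_exp_mul_ofReal (μ + 1) u)).neg
      refine h2.congr_deriv ?_
      have : Complex.exp ((μ + 1) * u) =
          Complex.exp (μ * u) * Complex.exp (-1 * ((-u : ℝ) : ℂ)) := by
        rw [← Complex.exp_add]
        congr 1
        push_cast
        ring
      simp only [Complex.ofRealCLM_apply, Complex.ofReal_one, this]
      push_cast
      ring
  have hz' := lambertChar_eq_zero_iff.1 hw
  have he : Complex.exp (-1) * Complex.exp (μ + 1) = Complex.exp μ := by
    rw [← Complex.exp_add]
    congr 1
    ring
  unfold delayTransform lambertChar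
  rw [mul_add, mul_left_comm _ (w : ℂ), hint]
  simp only [Complex.ofReal_zero, zero_mul, mul_zero, zero_add]
  rw [← hz']
  linear_combination μ * he

/-- Integration by parts. At a root the correction vanishes, so differentiation of `g` acts as
multiplication by the root. -/
lemma delayTransform_deriv {w : ℝ} {g : ℝ → ℂ} (hg : IsDelaySolution w g) (μ : ℂ) :
    delayTransform w (deriv g) μ = μ * delayTransform w g μ - g 0 * lambertChar w μ := by
  have hc := hg.continuous
  have hc' := hg.deriv.continuous
  have hint : ∫ u in (0 : ℝ)..1,
      (μ * (Complex.exp (μ * u) * g (-u)) - Complex.exp (μ * u) * deriv g (-u)) =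
      Complex.exp μ * g (-1) - g 0 := by
    rw [intervalIntegral.integral_eq_sub_of_hasDerivAt
        (f := fun u : ℝ => Complex.exp (μ * u) * g (-u)) (fun u _ => ?_)
        (Continuous.intervalIntegrable (by fun_prop) _ _)]
    · simp
    · have h1 : HasDerivAt (fun u : ℝ => g (-u)) (-deriv g (-u)) u := by
        have := (hg.1.differentiable (by simp) (-u)).hasDerivAt.scomp u (hasDerivAt_neg u)
        simpa [Function.comp_def] using this
      refine ((hasDerivAt_exp_mul_ofReal μ u).mul h1).congr_deriv ?_
      ring
  rw [intervalIntegral.integral_sub (Continuous.intervalIntegrable (by fun_prop) _ _)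
    (Continuous.intervalIntegrable (by fun_prop) _ _),
    intervalIntegral.integral_const_mul] at hint
  have h0 : deriv g 0 = w * g (-1) := by simpa using hg.2 0
  unfold delayTransform lambertChar
  rw [h0]
  linear_combination -(w : ℂ) * hint

lemma exists_delayTransform_eq_pow_mul {w : ℝ} {g : ℝ → ℂ} (hg : IsDelaySolution w g) (n : ℕ) :
    ∃ h : ℝ → ℂ, IsDelaySolution w h ∧
      ∀ z, lambertChar w z = 0 → delayTransform w h z = z ^ n * delayTransform w g z := by
  induction n with
  | zero => exact ⟨g, hg, by simp⟩
  | succ n ih =>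
    obtain ⟨h, h1, h2⟩ := ih
    refine ⟨deriv h, h1.deriv, fun z hz => ?_⟩
    rw [delayTransform_deriv h1, h2 z hz, hz]
    ring

/-- The correction carries the factor `lambertChar w z`, so at a root translation by `t` just
multiplies the transform by `e^{zt}`; this moves the expansion from `0` to any point. -/
lemma delayTransform_comp_add_const {w : ℝ} {g : ℝ → ℂ} (hg : IsDelaySolution w g) (t : ℝ)
    (z : ℂ) : delayTransform w (fun s => g (s + t)) z =
      Complex.exp (z * t) * (delayTransform w g z -
        lambertChar w z * ∫ v in (0 : ℝ)..t, Complex.exp (-z * v) * g v) := by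
  have hc := hg.continuous
  set G : ℝ → ℂ := fun v => Complex.exp (-z * v) * g v with hG
  have hGc : Continuous G := by fun_prop
  have hchange : ∀ t : ℝ, ∫ u in (0 : ℝ)..1, Complex.exp (z * u) * g (-u + t) =
      Complex.exp (z * t) * ((∫ v in (0 : ℝ)..t, G v) - ∫ v in (0 : ℝ)..(t - 1), G v) := by
    intro t
    rw [intervalIntegral.integral_interval_sub_left (hGc.intervalIntegrable _ _)
      (hGc.intervalIntegrable _ _), ← intervalIntegral.integral_const_mul]
    have := intervalIntegral.integral_comp_sub_left (a := 0) (b := 1)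
      (fun v => Complex.exp (z * t) * G v) t
    rw [sub_zero] at this
    rw [← this]
    refine intervalIntegral.integral_congr fun u _ => ?_
    simp only [hG]
    rw [← mul_assoc, ← Complex.exp_add, neg_add_eq_sub]
    congr 2
    push_cast
    ring
  -- A conserved quantity: its derivative cancels by the delay equation, and its value at `0` is the
  -- transform of `g`.
  set J : ℝ → ℂ := fun t => Complex.exp z * G t +
    w * ((∫ v in (0 : ℝ)..t, G v) - ∫ v in (0 : ℝ)..(t - 1), G v) +
      lambertChar w z * ∫ v in (0 : ℝ)..t, G v with hJ
  have hF : ∀ t, HasDerivAt (fun t : ℝ => ∫ v in (0 : ℝ)..t, G v) (G t) t := fun t =>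
    intervalIntegral.integral_hasDerivAt_right (hGc.intervalIntegrable _ _)
      (hGc.stronglyMeasurableAtFilter _ _) hGc.continuousAt
  have hGd : ∀ t : ℝ, HasDerivAt G (-z * Complex.exp (-z * t) * g t +
      Complex.exp (-z * t) * (w * g (t - 1))) t := fun t =>
    (hasDerivAt_exp_mul_ofReal (-z) t).mul (hg.hasDerivAt t)
  have hJd : ∀ t, HasDerivAt J 0 t := by
    intro t
    have h := (((hGd t).const_mul (Complex.exp z)).add
      (((hF t).sub ((hF (t - 1)).comp_sub_const t 1)).const_mul (w : ℂ))).add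
        ((hF t).const_mul (lambertChar w z))
    refine h.congr_deriv ?_
    have he : Complex.exp (-z * ((t - 1 : ℝ) : ℂ)) = Complex.exp z * Complex.exp (-z * t) := by
      rw [← Complex.exp_add]
      congr 1
      push_cast
      ring
    simp only [hG, he]
    unfold lambertChar
    ring
  have hJc : J t = J 0 :=
    is_const_of_deriv_eq_zero (fun t => (hJd t).differentiableAt) (fun t => (hJd t).deriv) t 0
  have h0 := hchange 0
  have ht := hchange t
  simp only [add_zero, Complex.ofReal_zero, mul_zero, Complex.exp_zero, one_mul] at h0
  simp only [hJ] at hJc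
  have hg0 : G 0 = g 0 := by simp [hG]
  have hgt : g t = Complex.exp (z * t) * G t := by
    simp only [hG]
    rw [← mul_assoc, ← Complex.exp_add]
    simp
  rw [hg0, ← h0, intervalIntegral.integral_same, mul_zero, add_zero] at hJc
  unfold delayTransform
  simp only [zero_add]
  rw [ht, hgt]
  linear_combination Complex.exp (z * t) * hJc

/-! ### Expansion of smooth solutions into exponentials -/

/-- `μ` enumerates the roots of the characteristic function, and only the root `-1` may be
repeated. -/
structure IsRootEnumeration (w : ℝ) (μ : ℤ → ℂ) : Prop where
  root : ∀ k, lambertChar w (μ k) = 0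
  surj : ∀ z, lambertChar w z = 0 → ∃ k, μ k = z
  inj : ∀ i j, μ i = μ j → μ i ≠ -1 → i = j
  growth : ∀ k : ℤ, |(k : ℝ)| ≤ ‖μ k‖ + 1

/-- The coefficient of `e^{zs}` in the expansion of a solution `g`, for a simple root `z`. -/
noncomputable def modeCoeff (w : ℝ) (g : ℝ → ℂ) (z : ℂ) : ℂ :=
  delayTransform w g z / ((1 + z) * Complex.exp z)

/-- Absolute values in `z e^z = w`. In particular `e^{Re z} ≤ 1` for roots with `|z| ≥ |w|`, where
transforms are therefore bounded. -/
lemma exp_re_of_root {w : ℝ} {z : ℂ} (hw : w ≠ 0) (hz : lambertChar w z = 0) :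
    z ≠ 0 ∧ Real.exp z.re = |w| / ‖z‖ := by
  have h := lambertChar_eq_zero_iff.1 hz
  have h0 : z ≠ 0 := by
    rintro rfl
    rw [zero_mul] at h
    exact hw (by exact_mod_cast h.symm)
  refine ⟨h0, ?_⟩
  rw [eq_div_iff (norm_ne_zero_iff.2 h0), mul_comm, ← norm_mul_exp, h, Complex.norm_real,
    Real.norm_eq_abs]

/-- On `[-1, 0]` the mode `e^{zs}` has size at most `max(1, e^{-Re z})`, and `e^{-Re z} = |z| / |w|`
at a root; this costs one power of `|z|`. -/
lemma norm_delayTransform_exp_le {w : ℝ} {z : ℂ} (hw : w ≠ 0) (hz : lambertChar w z = 0) (μ : ℂ) :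
    ‖delayTransform w (fun s => Complex.exp (z * s)) μ‖ ≤
      (1 + |w|) * (1 + ‖z‖ / |w|) * max 1 (Real.exp μ.re) := by
  refine norm_delayTransform_le (fun u hu => ?_) μ
  have h1 : z * ((-u : ℝ) : ℂ) = -z * u := by push_cast; ring
  rw [h1]
  refine (norm_exp_mul_le hu.1 hu.2).trans (max_le ?_ ?_)
  · have : 0 ≤ ‖z‖ / |w| := by positivity
    linarith
  · rw [Complex.neg_re, Real.exp_neg, (exp_re_of_root hw hz).2, inv_div]
    linarith

lemma summable_modeCoeff {w : ℝ} (hw : w ≠ 0) {μ : ℤ → ℂ} (hμ : IsRootEnumeration w μ)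
    {g : ℝ → ℂ} (hg : IsDelaySolution w g) :
    Summable fun k => ‖modeCoeff w g (μ k)‖ * (1 + ‖μ k‖ / |w|) := by
  -- Since `|(1 + z) e^z|` stays of order `|w|`, three derivatives give coefficients of order
  -- `|z|^{-3}`; the weight takes back one power, leaving a comparison with `∑ 1/k²`.
  obtain ⟨h, hh, hhg⟩ := exists_delayTransform_eq_pow_mul hg 3
  obtain ⟨C, hC0, hC⟩ := exists_norm_delayTransform_le w hh.continuous
  have hwp : 0 < |w| := abs_pos.2 hw
  have hs : Summable fun k : ℤ => 2 * C * (1 + 1 / |w|) / |w| * 4 * (1 / (k : ℝ) ^ 2) :=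
    ((Real.summable_one_div_int_pow (p := 2)).2 (by norm_num)).mul_left _
  -- With `growth`, `|k| ≥ N` forces `‖μ k‖ ≥ |w| + 2`, hence all of the bounds `hz2`, `hzw` and
  -- `hzk`.
  obtain ⟨N, hN⟩ := exists_nat_ge (|w| + 3)
  refine Summable.of_norm_bounded_eventually hs ?_
  have hfin : ∀ᶠ k : ℤ in Filter.cofinite, (N : ℝ) ≤ |(k : ℝ)| := by
    rw [Filter.eventually_cofinite]
    refine (Set.finite_Icc (-(N : ℤ)) N).subset fun k hk => ?_
    simp only [Set.mem_ofPred_eq, not_le] at hk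
    have : |k| < N := by exact_mod_cast hk
    rw [abs_lt] at this
    exact ⟨this.1.le, this.2.le⟩
  filter_upwards [hfin] with k hk
  have hgr := hμ.growth k
  have hroot := hμ.root k
  set z := μ k with hz
  have hz2 : 2 ≤ ‖z‖ := by linarith
  have hzw : |w| ≤ ‖z‖ := by linarith
  have hzk : |(k : ℝ)| ≤ 2 * ‖z‖ := by linarith
  have hzp : 0 < ‖z‖ := by linarith
  have hk0 : 0 < |(k : ℝ)| := by linarith
  obtain ⟨hz0, hre⟩ := exp_re_of_root hw hroot
  have h1 : ‖delayTransform w h z‖ ≤ C := by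
    have := hC z
    rwa [hre, max_eq_left ((div_le_one hzp).2 hzw), mul_one] at this
  have h2 : ‖z‖ / 2 ≤ ‖1 + z‖ := by
    have := norm_sub_norm_le z (-1)
    rw [norm_neg, norm_one, sub_neg_eq_add, add_comm z 1] at this
    linarith
  have h3 : ‖modeCoeff w g z‖ ≤ 2 * C / |w| / ‖z‖ ^ 3 := by
    have h4 : ‖modeCoeff w g z‖ = ‖delayTransform w h z‖ / (‖z‖ ^ 2 * ‖1 + z‖ * |w|) := by
      unfold modeCoeff
      rw [hhg z hroot, norm_div, norm_mul, norm_mul, norm_pow, Complex.norm_exp, hre]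
      rw [div_eq_div_iff]
      · field_simp
      · have : 0 < ‖1 + z‖ := by linarith
        positivity
      · have : 0 < ‖1 + z‖ := by linarith
        positivity
    rw [h4]
    calc _ ≤ C / (‖z‖ ^ 2 * (‖z‖ / 2) * |w|) := by gcongr
      _ = _ := by field_simp
  rw [Real.norm_of_nonneg (by positivity)]
  calc ‖modeCoeff w g z‖ * (1 + ‖z‖ / |w|)
      ≤ 2 * C / |w| / ‖z‖ ^ 3 * (‖z‖ * (1 + 1 / |w|)) := by
        gcongr
        have : ‖z‖ * (1 + 1 / |w|) = ‖z‖ + ‖z‖ / |w| := by ring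
        linarith
    _ = 2 * C * (1 + 1 / |w|) / |w| * 4 * (1 / (2 * ‖z‖) ^ 2) := by field_simp; ring
    _ ≤ 2 * C * (1 + 1 / |w|) / |w| * 4 * (1 / |(k : ℝ)| ^ 2) := by gcongr
    _ = _ := by rw [sq_abs]

lemma delayTransform_exp_eq_zero {w : ℝ} {z z' : ℂ} (hz : lambertChar w z = 0)
    (hz' : lambertChar w z' = 0) (hne : z' ≠ z) :
    delayTransform w (fun s => Complex.exp (z * s)) z' = 0 := by
  have h := sub_mul_delayTransform_exp hz z'
  rw [hz'] at h
  exact (mul_eq_zero.1 h).resolve_left (sub_ne_zero.2 hne)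

/-- Differentiating `(μ - z) K(μ) = D(μ)`. At `μ = z` this gives `K(z) = D'(z)`; at a double root
`-1 ≠ z` it gives `K'(-1) = 0`. -/
lemma delayTransform_exp_add_sub_mul_deriv {w : ℝ} {z : ℂ} (hz : lambertChar w z = 0) (μ : ℂ) :
    delayTransform w (fun s => Complex.exp (z * s)) μ +
      (μ - z) * deriv (delayTransform w (fun s => Complex.exp (z * s))) μ =
        (1 + μ) * Complex.exp μ := by
  have hd := (differentiable_delayTransform w (isDelaySolution_exp hz).continuous μ).hasDerivAt
  have h1 := ((hasDerivAt_id μ).sub_const z).mul hd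
  have h2 := hasDerivAt_lambertChar w μ
  have h3 : lambertChar w =
      (fun x => x - z) * delayTransform w (fun s => Complex.exp (z * s)) :=
    funext fun x => (sub_mul_delayTransform_exp hz x).symm
  rw [h3] at h2
  have h4 := h1.unique h2
  simpa using h4

lemma delayTransform_exp_self {w : ℝ} {z : ℂ} (hz : lambertChar w z = 0) :
    delayTransform w (fun s => Complex.exp (z * s)) z = (1 + z) * Complex.exp z := by
  simpa using delayTransform_exp_add_sub_mul_deriv hz z

lemma deriv_delayTransform_exp_neg_one {w : ℝ} {z : ℂ} (hw : lambertChar w (-1) = 0)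
    (hz : lambertChar w z = 0) (hne : z ≠ -1) :
    deriv (delayTransform w (fun s => Complex.exp (z * s))) (-1) = 0 := by
  have h := delayTransform_exp_add_sub_mul_deriv hz (-1)
  rw [delayTransform_exp_eq_zero hz hw hne.symm, zero_add, add_neg_cancel, zero_mul] at h
  exact (mul_eq_zero.1 h).resolve_left (sub_ne_zero.2 hne.symm)

/-- The value at `0` of a smooth solution without a component at the double root is the sum of
its coefficients. -/
theorem hasSum_modeCoeff {w : ℝ} (hw : w ≠ 0) {μ : ℤ → ℂ} (hμ : IsRootEnumeration w μ)
    {g : ℝ → ℂ} (hg : IsDelaySolution w g)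
    (h0 : lambertChar w (-1) = 0 → delayTransform w g (-1) = 0)
    (h1 : lambertChar w (-1) = 0 → deriv (delayTransform w g) (-1) = 0) :
    HasSum (fun k => modeCoeff w g (μ k)) (g 0) := by
  set K : ℤ → ℂ → ℂ := fun k => delayTransform w (fun s => Complex.exp (μ k * s)) with hK
  set c : ℤ → ℂ := fun k => modeCoeff w g (μ k) with hc
  set b : ℤ → ℝ := fun k => (1 + |w|) * (‖c k‖ * (1 + ‖μ k‖ / |w|)) with hb
  have hbs : Summable b := (summable_modeCoeff hw hμ hg).mul_left _
  have hb0 : ∀ k, 0 ≤ b k := fun k => by positivity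
  have hKc : ∀ k, Continuous fun s : ℝ => Complex.exp (μ k * s) := fun k =>
    (isDelaySolution_exp (hμ.root k)).continuous
  have hKb : ∀ k x, ‖c k * K k x‖ ≤ b k * max 1 (Real.exp x.re) := by
    intro k x
    rw [norm_mul]
    calc ‖c k‖ * ‖K k x‖
        ≤ ‖c k‖ * ((1 + |w|) * (1 + ‖μ k‖ / |w|) * max 1 (Real.exp x.re)) := by
          gcongr
          exact norm_delayTransform_exp_le hw (hμ.root k) x
      _ = _ := by rw [hb]; ring
  have hKd : ∀ k, Differentiable ℂ (fun x => c k * K k x) := fun k =>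
    (differentiable_delayTransform w (hKc k)).const_mul _
  set H : ℂ → ℂ := fun x => ∑' k, c k * K k x with hH
  -- the half planes on which the series converges uniformly
  have hopen : ∀ M : ℝ, IsOpen {x : ℂ | x.re < M} := fun M =>
    isOpen_lt Complex.continuous_re continuous_const
  have hsum : ∀ M : ℝ, Summable fun k => b k * max 1 (Real.exp M) := fun M => hbs.mul_right _
  have hle : ∀ (M : ℝ) k, ∀ x ∈ {x : ℂ | x.re < M}, ‖c k * K k x‖ ≤ b k * max 1 (Real.exp M) := by
    intro M k x hx
    refine (hKb k x).trans ?_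
    have : x.re ≤ M := le_of_lt hx
    have := hb0 k
    gcongr
  have hHd : Differentiable ℂ H := fun x =>
    (Complex.differentiableOn_tsum_of_summable_norm (hsum (x.re + 1))
      (fun k => (hKd k).differentiableOn) (hopen _) (hle _)).differentiableAt
      ((hopen _).mem_nhds (lt_add_one x.re))
  have hHb : ∀ x, ‖H x‖ ≤ (∑' k, b k) * max 1 (Real.exp x.re) := by
    intro x
    rw [← tsum_mul_right]
    exact tsum_of_norm_bounded (hsum x.re).hasSum (fun k => hKb k x)
  obtain ⟨C, -, hC⟩ := exists_norm_delayTransform_le w hg.continuous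
  have hQd := differentiable_delayTransform w hg.continuous
  -- The denominator of `modeCoeff` vanishes at `-1`, so division by zero makes the coefficient `0`,
  -- and the repeated listing of the double root is harmless.
  have hcz : ∀ k, μ k = -1 → c k = 0 := by
    intro k hk
    simp [hc, modeCoeff, hk]
  -- By biorthogonality only the term of the root itself survives, and it equals the transform of
  -- `g` there; at `-1` both sides are zero.
  have hHz : ∀ z, lambertChar w z = 0 → delayTransform w g z - H z = 0 := by
    intro z hz
    obtain ⟨j, rfl⟩ := hμ.surj z hz
    by_cases hj : μ j = -1
    · have hH0 : H (μ j) = 0 := by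
        refine (tsum_congr fun k => ?_).trans tsum_zero
        by_cases hk : μ k = -1
        · rw [hcz k hk, zero_mul]
        · simp only [hK]
          rw [delayTransform_exp_eq_zero (hμ.root k) hz (by rw [hj]; exact Ne.symm hk), mul_zero]
      rw [hH0, hj, h0 (hj ▸ hz), sub_zero]
    · have hHj : H (μ j) = c j * K j (μ j) := by
        refine tsum_eq_single j fun k hk => ?_
        simp only [hK]
        rw [delayTransform_exp_eq_zero (hμ.root k) hz fun h => hk (hμ.inj j k h hj).symm, mul_zero]
      have hne : (1 + μ j) * Complex.exp (μ j) ≠ 0 :=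
        mul_ne_zero (fun h => hj (eq_neg_of_add_eq_zero_right h)) (Complex.exp_ne_zero _)
      rw [hHj]
      simp only [hK, hc, modeCoeff]
      rw [delayTransform_exp_self hz, div_mul_cancel₀ _ hne, sub_self]
  have hT : ∀ z, delayTransform w g z - H z = 0 := by
    refine eq_zero_of_norm_le_max_one_exp hw (hQd.sub hHd) (C := C + ∑' k, b k) (fun z => ?_) hHz ?_
    · rw [add_mul]
      exact (norm_sub_le _ _).trans (add_le_add (hC z) (hHb z))
    · intro hw1
      have hdH : deriv H (-1) = 0 := by
        have h2 := Complex.hasSum_deriv_of_summable_norm (hsum ((-1 : ℂ).re + 1))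
          (fun k => (hKd k).differentiableOn) (hopen _) (hle _)
          (show (-1 : ℂ) ∈ {x : ℂ | x.re < (-1 : ℂ).re + 1} from lt_add_one (-1 : ℂ).re)
        refine h2.unique ?_
        have h3 : (fun k => deriv (fun x => c k * K k x) (-1)) = fun _ => 0 := by
          funext k
          rw [deriv_const_mul _ (differentiable_delayTransform w (hKc k) _)]
          by_cases hk : μ k = -1
          · rw [hcz k hk, zero_mul]
          · rw [deriv_delayTransform_exp_neg_one hw1 (hμ.root k) hk, mul_zero]
        rw [h3]
        exact hasSum_zero
      refine ((hQd (-1)).hasDerivAt.sub (hHd (-1)).hasDerivAt).deriv.trans ?_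
      rw [h1 hw1, hdH, sub_zero]
  -- compare the growth at `+∞`
  have hlim1 := tendsto_exp_neg_mul_delayTransform w hg.continuous
  -- Each mode has value `1` at `0`, so the termwise limits are the coefficients; `b` dominates.
  have hlim2 : Filter.Tendsto (fun x : ℝ => ∑' k, Complex.exp (-x) * (c k * K k x)) Filter.atTop
      (nhds (∑' k, c k)) := by
    refine tendsto_tsum_of_dominated_convergence hbs (fun k => ?_) ?_
    · have := (tendsto_exp_neg_mul_delayTransform w (hKc k)).const_mul (c k)
      simp only [Complex.ofReal_zero, mul_zero, Complex.exp_zero, mul_one] at this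
      refine this.congr fun x => ?_
      simp only [hK]
      ring
    · filter_upwards [Filter.eventually_ge_atTop 0] with x hx k
      have h2 := hKb k x
      rw [Complex.ofReal_re, max_eq_right (Real.one_le_exp hx)] at h2
      rw [norm_mul, Complex.norm_exp, Complex.neg_re, Complex.ofReal_re]
      calc Real.exp (-x) * ‖c k * K k x‖ ≤ Real.exp (-x) * (b k * Real.exp x) := by gcongr
        _ = b k * Real.exp (-x + x) := by rw [Real.exp_add]; ring
        _ = b k := by simp
  have hcs : Summable c := by
    refine Summable.of_norm_bounded hbs fun k => ?_
    have h2 : 0 ≤ ‖μ k‖ / |w| := by positivity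
    have h3 := norm_nonneg (c k)
    have h4 := abs_nonneg w
    simp only [hb]
    nlinarith [mul_nonneg h3 h2, mul_nonneg h4 h3, mul_nonneg h4 (mul_nonneg h3 h2)]
  have heq : ∑' k, c k = g 0 := by
    refine tendsto_nhds_unique hlim2 (hlim1.congr fun x => ?_)
    rw [tsum_mul_left, sub_eq_zero.1 (hT x)]
  rw [← heq]
  exact hcs.hasSum

/-- The derivative of a product at a zero of one factor, where that factor has derivative `0`. -/
lemma HasDerivAt.mul_of_continuousAt {f S : ℂ → ℂ} {z : ℂ} (hf : HasDerivAt f 0 z) (hz : f z = 0)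
    (hS : ContinuousAt S z) : HasDerivAt (fun x => f x * S x) 0 z := by
  rw [hasDerivAt_iff_isLittleO] at hf ⊢
  simp only [hz, smul_zero, sub_zero, zero_mul] at hf ⊢
  simpa using hf.mul_isBigO (hS.tendsto.isBigO_one ℂ)

/-- The expansion of a smooth solution without a component at the double root. -/
theorem hasSum_modeCoeff_mul_exp {w : ℝ} (hw : w ≠ 0) {μ : ℤ → ℂ} (hμ : IsRootEnumeration w μ)
    {g : ℝ → ℂ} (hg : IsDelaySolution w g)
    (h0 : lambertChar w (-1) = 0 → delayTransform w g (-1) = 0)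
    (h1 : lambertChar w (-1) = 0 → deriv (delayTransform w g) (-1) = 0) (s : ℝ) :
    HasSum (fun k => modeCoeff w g (μ k) * Complex.exp (μ k * s)) (g s) := by
  have hsh := delayTransform_comp_add_const hg s
  have hsum := hasSum_modeCoeff hw hμ (hg.comp_add_const s) (fun hw1 => ?_) (fun hw1 => ?_)
  · simp only [zero_add] at hsum
    refine hsum.congr_fun fun k => ?_
    unfold modeCoeff
    rw [hsh, hμ.root k]
    ring
  · rw [hsh, h0 hw1, hw1]
    ring
  · have hfun : delayTransform w (fun t => g (t + s)) =
        fun z => Complex.exp (z * s) * (delayTransform w g z -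
          lambertChar w z * ∫ v in (0 : ℝ)..s, Complex.exp (-z * v) * g v) := funext hsh
    -- Continuity of the integral in `z` is enough, because it is multiplied by a function with a
    -- double zero at `-1`.
    have hS : ContinuousAt (fun z : ℂ => ∫ v in (0 : ℝ)..s, Complex.exp (-z * v) * g v) (-1) := by
      have := hg.continuous
      exact (intervalIntegral.continuous_parametric_intervalIntegral_of_continuous'
        (by fun_prop) 0 s).continuousAt
    have hD : HasDerivAt (lambertChar w) 0 (-1) := by
      simpa using hasDerivAt_lambertChar w (-1)
    have hQ := (differentiable_delayTransform w hg.continuous (-1)).hasDerivAt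
    rw [h1 hw1] at hQ
    have hE : HasDerivAt (fun z : ℂ => Complex.exp (z * s)) (Complex.exp (-1 * s) * s) (-1) := by
      simpa using ((hasDerivAt_id (-1 : ℂ)).mul_const (s : ℂ)).cexp
    have h2 := hE.mul (hQ.sub (hD.mul_of_continuousAt hw1 hS))
    rw [hfun]
    refine h2.deriv.trans ?_
    simp [h0 hw1, hw1]

/-- The expansion of a smooth solution; at the double root `-1` the second mode is `s e^{-s}`. -/
theorem exists_hasSum_modes {w : ℝ} (hw : w ≠ 0) {μ : ℤ → ℂ} (hμ : IsRootEnumeration w μ)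
    {g : ℝ → ℂ} (hg : IsDelaySolution w g) :
    ∃ c : ℤ → ℂ, ∃ c₀ c₁ : ℂ, (lambertChar w (-1) ≠ 0 → c₀ = 0 ∧ c₁ = 0) ∧
      (∀ k, μ k = -1 → c k = 0) ∧
      ∀ s : ℝ, HasSum (fun k => c k * Complex.exp (μ k * s))
        (g s - (c₀ * Complex.exp (-1 * s) + c₁ * (s * Complex.exp (-1 * s)))) := by
  by_cases hw1 : lambertChar w (-1) = 0
  swap
  · refine ⟨fun k => modeCoeff w g (μ k), 0, 0, by simp, fun k hk => by simp [modeCoeff, hk],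
      fun s => ?_⟩
    simpa using hasSum_modeCoeff_mul_exp hw hμ hg (fun h => absurd h hw1) (fun h => absurd h hw1) s
  set K := delayTransform w (fun s => Complex.exp (-1 * s)) with hK
  set L := delayTransform w (fun s => s * Complex.exp (-1 * s)) with hL
  have hKs := isDelaySolution_exp hw1
  have hLs := isDelaySolution_mul_exp hw1
  have hLd : Differentiable ℂ L := differentiable_delayTransform w hLs.continuous
  have hKd : Differentiable ℂ K := differentiable_delayTransform w hKs.continuous
  -- Both `(z + 1) K` and `(z + 1)² L` equal the characteristic function. Hence `K(-1) = 0` and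
  -- `K'(-1) = L(-1)`, and the system for `c₀, c₁` is triangular.
  have hKL : K = fun z => (z + 1) * L z := by
    refine Continuous.ext_on (dense_compl_singleton (-1 : ℂ)) hKd.continuous
      ((continuous_id.add continuous_const).mul hLd.continuous) fun z hz => ?_
    have hz1 : z + 1 ≠ 0 := fun h => hz (eq_neg_of_add_eq_zero_left h)
    refine mul_left_cancel₀ hz1 ?_
    have h1 := sub_mul_delayTransform_exp hw1 z
    rw [sub_neg_eq_add] at h1
    rw [← mul_assoc, ← pow_two]
    exact h1.trans (add_one_sq_mul_delayTransform_mul_exp hw1 z).symm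
  have hL1 : L (-1) ≠ 0 := by
    have h1 : ∫ u in (0 : ℝ)..1,
        Complex.exp (-1 * u) * (((-u : ℝ) : ℂ) * Complex.exp (-1 * ((-u : ℝ) : ℂ))) =
        ((∫ u in (0 : ℝ)..1, -u : ℝ) : ℂ) := by
      rw [← intervalIntegral.integral_ofReal]
      refine intervalIntegral.integral_congr fun u _ => ?_
      rw [mul_left_comm, ← Complex.exp_add]
      simp
    have h2 : L (-1) = -(w / 2) := by
      rw [hL]
      unfold delayTransform
      rw [h1, intervalIntegral.integral_neg, integral_id]
      simp
      ring
    rw [h2]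
    simpa using hw
  have hK1 : deriv K (-1) = L (-1) := by
    rw [hKL]
    have h1 := ((hasDerivAt_id (-1 : ℂ)).add_const 1).mul (hLd (-1)).hasDerivAt
    refine h1.deriv.trans ?_
    simp
  have hK0 : K (-1) = 0 := by rw [hKL]; simp
  set Q := delayTransform w g with hQ
  have hQd : Differentiable ℂ Q := differentiable_delayTransform w hg.continuous
  -- `c₁` cancels the value of the transform at `-1`, then `c₀` cancels its derivative.
  set c₁ := Q (-1) / L (-1) with hc₁
  set c₀ := (deriv Q (-1) - c₁ * deriv L (-1)) / L (-1) with hc₀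
  have hcomb := (hg.sub (hKs.const_mul c₀)).sub (hLs.const_mul c₁)
  have htr : delayTransform w (fun s => g s - c₀ * Complex.exp (-1 * s) -
      c₁ * (s * Complex.exp (-1 * s))) = fun z => Q z - c₀ * K z - c₁ * L z := by
    funext z
    rw [delayTransform_sub w (hg.sub (hKs.const_mul c₀)).continuous (hLs.const_mul c₁).continuous,
      delayTransform_sub w hg.continuous (hKs.const_mul c₀).continuous,
      delayTransform_const_mul, delayTransform_const_mul]
  refine ⟨fun k => modeCoeff w (fun s => g s - c₀ * Complex.exp (-1 * s) -
      c₁ * (s * Complex.exp (-1 * s))) (μ k), c₀, c₁, fun h => absurd hw1 h,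
    fun k hk => by simp [modeCoeff, hk], fun s => ?_⟩
  rw [← sub_sub]
  refine hasSum_modeCoeff_mul_exp hw hμ hcomb (fun _ => ?_) (fun _ => ?_) s
  · rw [htr]
    simp only
    rw [hK0, mul_zero, sub_zero, hc₁, div_mul_cancel₀ _ hL1, sub_self]
  · rw [htr]
    refine (((hQd (-1)).hasDerivAt.sub ((hKd (-1)).hasDerivAt.const_mul c₀)).sub
      ((hLd (-1)).hasDerivAt.const_mul c₁)).deriv.trans ?_
    rw [hK1, hc₀, div_mul_cancel₀ _ hL1]
    ring

/-! ### The branches of the Lambert function at a real argument -/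

lemma strictMonoOn_mul_exp : StrictMonoOn (fun x : ℝ => x * Real.exp x) (Set.Ici (-1)) := by
  refine strictMonoOn_of_deriv_pos (convex_Ici _) (by fun_prop) fun x hx => ?_
  rw [interior_Ici, Set.mem_Ioi] at hx
  have h := (hasDerivAt_id x).mul (Real.hasDerivAt_exp x)
  refine lt_of_lt_of_eq ?_ h.deriv.symm
  simp only [id]
  nlinarith [Real.exp_pos x]

lemma strictAntiOn_mul_exp : StrictAntiOn (fun x : ℝ => x * Real.exp x) (Set.Iic (-1)) := by
  refine strictAntiOn_of_deriv_neg (convex_Iic _) (by fun_prop) fun x hx => ?_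
  rw [interior_Iic, Set.mem_Iio] at hx
  have h := (hasDerivAt_id x).mul (Real.hasDerivAt_exp x)
  refine lt_of_eq_of_lt h.deriv ?_
  simp only [id]
  nlinarith [Real.exp_pos x]

lemma neg_exp_neg_one_le_mul_exp (x : ℝ) : -Real.exp (-1) ≤ x * Real.exp x := by
  have h := Real.add_one_le_exp (-x - 1)
  have h2 : Real.exp (-x - 1) * Real.exp x = Real.exp (-1) := by
    rw [← Real.exp_add]
    congr 1
    ring
  nlinarith [Real.exp_pos x]

lemma exists_pos_mul_exp_eq {w : ℝ} (hw : 0 < w) : ∃ x, 0 < x ∧ x * Real.exp x = w := by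
  have h := intermediate_value_Icc hw.le
    (f := fun x : ℝ => x * Real.exp x) (by fun_prop)
  obtain ⟨x, hx, hxw⟩ := h ⟨by simpa using hw.le, by nlinarith [Real.one_le_exp hw.le]⟩
  refine ⟨x, lt_of_le_of_ne hx.1 ?_, hxw⟩
  rintro rfl
  simp at hxw
  exact hw.ne hxw

lemma exists_mem_Ico_mul_exp_eq {w : ℝ} (hw : w < 0) (hw1 : -Real.exp (-1) ≤ w) :
    ∃ x, -1 ≤ x ∧ x < 0 ∧ x * Real.exp x = w := by
  have h := intermediate_value_Icc (show (-1 : ℝ) ≤ 0 by norm_num)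
    (f := fun x : ℝ => x * Real.exp x) (by fun_prop)
  obtain ⟨x, hx, hxw⟩ := h ⟨by simpa using hw1, by simpa using hw.le⟩
  refine ⟨x, hx.1, lt_of_le_of_ne hx.2 ?_, hxw⟩
  rintro rfl
  simp at hxw
  exact hw.ne hxw.symm

lemma exists_le_neg_one_mul_exp_eq {w : ℝ} (hw : w < 0) (hw1 : -Real.exp (-1) ≤ w) :
    ∃ x, x ≤ -1 ∧ x * Real.exp x = w := by
  have hlim := Real.tendsto_pow_mul_exp_neg_atTop_nhds_zero 1
  obtain ⟨y, hy, hy1⟩ := ((hlim.eventually_le_const (neg_pos.2 hw)).and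
    (Filter.eventually_ge_atTop 1)).exists
  rw [pow_one] at hy
  have h := intermediate_value_Icc' (show -y ≤ -1 by linarith)
    (f := fun x : ℝ => x * Real.exp x) (by fun_prop)
  obtain ⟨x, hx, hxw⟩ := h ⟨by simpa using hw1, by linarith⟩
  exact ⟨x, hx.2, hxw⟩

/-! ### Nonreal roots on the curves of constant phase. -/

/-- The logarithm of `|z e^z|` along the curve of the points `z` in the upper half plane with
`Im z + arg z = (m + 1) π`, as a function of `t = π - arg z`. -/
noncomputable def branchLog (m : ℕ) (t : ℝ) : ℝ :=
  Real.log (m * Real.pi + t) - Real.log (Real.sin t) -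
    (m * Real.pi + t) * (Real.cos t / Real.sin t)

/-- Written with a sum of squares in the numerator, so that positivity, hence uniqueness of the root
on each curve, is visible. -/
lemma hasDerivAt_branchLog (m : ℕ) {t : ℝ} (ht : t ∈ Set.Ioo 0 Real.pi) :
    HasDerivAt (branchLog m) (((1 - (m * Real.pi + t) * (Real.cos t / Real.sin t)) ^ 2 +
      (m * Real.pi + t) ^ 2) / (m * Real.pi + t)) t := by
  have hs := Real.sin_pos_of_mem_Ioo ht
  have hy : 0 < m * Real.pi + t := by
    have := ht.1
    positivity
  have h1 := (hasDerivAt_id t).const_add (m * Real.pi)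
  have h := ((h1.log hy.ne').sub ((Real.hasDerivAt_sin t).log hs.ne')).sub
    (h1.mul ((Real.hasDerivAt_cos t).div (Real.hasDerivAt_sin t) hs.ne'))
  refine h.congr_deriv ?_
  simp only [id, Pi.div_apply]
  field_simp
  ring

lemma continuousOn_branchLog (m : ℕ) : ContinuousOn (branchLog m) (Set.Ioo 0 Real.pi) :=
  fun _ ht => (hasDerivAt_branchLog m ht).continuousAt.continuousWithinAt

lemma strictMonoOn_branchLog (m : ℕ) : StrictMonoOn (branchLog m) (Set.Ioo 0 Real.pi) := by
  refine strictMonoOn_of_deriv_pos (convex_Ioo _ _) (continuousOn_branchLog m) fun t ht => ?_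
  rw [interior_Ioo] at ht
  rw [(hasDerivAt_branchLog m ht).deriv]
  have hy : 0 < m * Real.pi + t := by
    have := ht.1
    positivity
  positivity

lemma mul_cos_lt_sin {t : ℝ} (ht : t ∈ Set.Ioo 0 Real.pi) : t * Real.cos t < Real.sin t := by
  have hs := Real.sin_pos_of_mem_Ioo ht
  rcases lt_or_ge t (Real.pi / 2) with h | h
  · have h1 := Real.lt_tan ht.1 h
    have hc := Real.cos_pos_of_mem_Ioo ⟨by linarith [ht.1], h⟩
    rwa [Real.tan_eq_sin_div_cos, lt_div_iff₀ hc] at h1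
  · have hc := Real.cos_nonpos_of_pi_div_two_le_of_le h (by linarith [ht.2])
    nlinarith [ht.1]

/-- From `sin t ≤ t` and `t cot t < 1`. The curve `m = 0` starts at the branch point `-1`, so it
meets only values with `|w| > 1/e`. -/
lemma neg_one_lt_branchLog_zero {t : ℝ} (ht : t ∈ Set.Ioo 0 Real.pi) : -1 < branchLog 0 t := by
  have hs := Real.sin_pos_of_mem_Ioo ht
  have h1 := Real.log_le_log hs (Real.sin_le ht.1.le)
  have h2 : t * (Real.cos t / Real.sin t) < 1 := by
    rw [← mul_div_assoc, div_lt_one hs]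
    exact mul_cos_lt_sin ht
  unfold branchLog
  simp only [Nat.cast_zero, zero_mul, zero_add]
  linarith

lemma tendsto_inv_sin_zero :
    Filter.Tendsto (fun t : ℝ => (Real.sin t)⁻¹) (nhdsWithin 0 (Set.Ioi 0)) Filter.atTop := by
  refine tendsto_inv_nhdsGT_zero.comp (tendsto_nhdsWithin_iff.2 ⟨?_, ?_⟩)
  · have := Real.continuous_sin.tendsto 0
    rw [Real.sin_zero] at this
    exact this.mono_left nhdsWithin_le_nhds
  · filter_upwards [Ioo_mem_nhdsGT Real.pi_pos] with t ht
    exact Real.sin_pos_of_mem_Ioo ht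

lemma tendsto_cos_zero :
    Filter.Tendsto Real.cos (nhdsWithin 0 (Set.Ioi 0)) (nhds 1) := by
  have := Real.continuous_cos.tendsto 0
  rw [Real.cos_zero] at this
  exact this.mono_left nhdsWithin_le_nhds

/-- As `t` tends to `π` the real part `-(mπ + t) cot t` tends to `+∞`. -/
lemma exists_le_branchLog (m : ℕ) (c : ℝ) : ∃ t ∈ Set.Ioo 0 Real.pi, c ≤ branchLog m t := by
  have hlim := tendsto_cos_zero.pos_mul_atTop one_pos tendsto_inv_sin_zero
  obtain ⟨s, hs, hs0, hs1⟩ := ((hlim.eventually_ge_atTop |c|).and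
    (Ioo_mem_nhdsGT (show (0 : ℝ) < Real.pi / 2 by positivity))).exists
  have hpi := Real.pi_gt_three
  have hsin : 0 < Real.sin s := Real.sin_pos_of_pos_of_lt_pi hs0 (by linarith)
  refine ⟨Real.pi - s, ⟨by linarith, by linarith⟩, ?_⟩
  unfold branchLog
  rw [Real.sin_pi_sub, Real.cos_pi_sub]
  have hm : (0 : ℝ) ≤ m * Real.pi := by positivity
  have h1 : 0 ≤ Real.log (m * Real.pi + (Real.pi - s)) := Real.log_nonneg (by linarith)
  have h2 : Real.log (Real.sin s) ≤ 0 := Real.log_nonpos hsin.le (Real.sin_le_one s)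
  have h3 : 1 ≤ m * Real.pi + (Real.pi - s) := by linarith
  have h4 : |c| ≤ (m * Real.pi + (Real.pi - s)) * (Real.cos s * (Real.sin s)⁻¹) := by
    nlinarith [abs_nonneg c]
  have h5 := le_abs_self c
  rw [neg_div, div_eq_mul_inv]
  linarith

/-- As `t` tends to `0`, `-log sin t ≤ 1 / sin t - 1` is beaten by `(mπ + t) cot t`, because `mπ + t
> π > 1`; this needs `m ≥ 1`. -/
lemma exists_branchLog_le {m : ℕ} (hm : 1 ≤ m) (c : ℝ) :
    ∃ t ∈ Set.Ioo 0 Real.pi, branchLog m t ≤ c := by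
  have hpi := Real.pi_gt_three
  have hlim1 : Filter.Tendsto (fun t => 1 - Real.pi * Real.cos t) (nhdsWithin 0 (Set.Ioi 0))
      (nhds (1 - Real.pi * 1)) := (tendsto_cos_zero.const_mul Real.pi).const_sub 1
  have hlim := hlim1.neg_mul_atTop (by linarith) tendsto_inv_sin_zero
  obtain ⟨t, ht, ht0, ht1⟩ := ((hlim.eventually_le_atBot
    (c - Real.log (m * Real.pi + Real.pi))).and
    (Ioo_mem_nhdsGT (show (0 : ℝ) < Real.pi / 2 by positivity))).exists
  have hsin : 0 < Real.sin t := Real.sin_pos_of_pos_of_lt_pi ht0 (by linarith)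
  have hcos : 0 < Real.cos t := Real.cos_pos_of_mem_Ioo ⟨by linarith, ht1⟩
  refine ⟨t, ⟨ht0, by linarith⟩, ?_⟩
  have hm1 : Real.pi ≤ m * Real.pi := by
    have : (1 : ℝ) ≤ m := by exact_mod_cast hm
    nlinarith
  have h1 : Real.log (m * Real.pi + t) ≤ Real.log (m * Real.pi + Real.pi) :=
    Real.log_le_log (by linarith) (by linarith)
  have h2 := Real.log_le_sub_one_of_pos (inv_pos.2 hsin)
  rw [Real.log_inv] at h2
  have h3 : Real.pi * (Real.cos t * (Real.sin t)⁻¹) ≤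
      (m * Real.pi + t) * (Real.cos t * (Real.sin t)⁻¹) := by
    gcongr
    linarith
  unfold branchLog
  rw [div_eq_mul_inv]
  linarith

/-- For `m = 0` the function equals `-log (sinc t) - cos t / sinc t`, with limit `-1` at `0`. -/
lemma exists_branchLog_zero_le {c : ℝ} (hc : -1 < c) :
    ∃ t ∈ Set.Ioo 0 Real.pi, branchLog 0 t ≤ c := by
  have h0 : Real.sinc 0 = 1 := Real.sinc_zero
  have hlim : Filter.Tendsto (fun t => -Real.log (Real.sinc t) - Real.cos t / Real.sinc t)
      (nhdsWithin 0 (Set.Ioi 0)) (nhds (-1)) := by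
    have h1 : Filter.Tendsto Real.sinc (nhdsWithin 0 (Set.Ioi 0)) (nhds 1) := by
      have := Real.continuous_sinc.tendsto 0
      rw [h0] at this
      exact this.mono_left nhdsWithin_le_nhds
    have h2 := (h1.log one_ne_zero).neg.sub (tendsto_cos_zero.div h1 one_ne_zero)
    simpa using h2
  obtain ⟨t, ht, ht0⟩ := ((hlim.eventually_le_const hc).and (Ioo_mem_nhdsGT Real.pi_pos)).exists
  refine ⟨t, ht0, ?_⟩
  have hs := Real.sin_pos_of_mem_Ioo ht0
  have htne : t ≠ 0 := ht0.1.ne'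
  rw [Real.sinc_of_ne_zero htne, Real.log_div hs.ne' htne] at ht
  unfold branchLog
  simp only [Nat.cast_zero, zero_mul, zero_add]
  refine le_trans (le_of_eq ?_) ht
  field_simp
  ring

lemma exists_branchLog_eq (m : ℕ) {c : ℝ} (h : 1 ≤ m ∨ -1 < c) :
    ∃ t ∈ Set.Ioo 0 Real.pi, branchLog m t = c := by
  obtain ⟨t₁, ht₁, h₁⟩ : ∃ t ∈ Set.Ioo 0 Real.pi, branchLog m t ≤ c := by
    rcases h with h | h
    · exact exists_branchLog_le h c
    · rcases Nat.eq_zero_or_pos m with rfl | hm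
      · exact exists_branchLog_zero_le h
      · exact exists_branchLog_le hm c
  obtain ⟨t₂, ht₂, h₂⟩ := exists_le_branchLog m c
  exact isPreconnected_Ioo.intermediate_value ht₁ ht₂ (continuousOn_branchLog m) ⟨h₁, h₂⟩

/-- The point of the upper half plane with `Im z = mπ + t` and `arg z = π - t`. -/
noncomputable def branchPoint (m : ℕ) (t : ℝ) : ℂ :=
  ⟨-((m * Real.pi + t) * (Real.cos t / Real.sin t)), m * Real.pi + t⟩

lemma branchPoint_eq (m : ℕ) {t : ℝ} (ht : t ∈ Set.Ioo 0 Real.pi) :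
    branchPoint m t = (((m * Real.pi + t) / Real.sin t : ℝ) : ℂ) *
      (Complex.cos ((Real.pi - t : ℝ) : ℂ) + Complex.sin ((Real.pi - t : ℝ) : ℂ) * Complex.I) := by
  have hs := (Real.sin_pos_of_mem_Ioo ht).ne'
  rw [← Complex.ofReal_cos, ← Complex.ofReal_sin, Real.cos_pi_sub, Real.sin_pi_sub]
  refine Complex.ext ?_ ?_
  · simp only [branchPoint, Complex.add_re, Complex.ofReal_re,
      Complex.mul_re, Complex.I_re, Complex.I_im, Complex.ofReal_im]
    field_simp
    ring
  · simp only [branchPoint, Complex.add_im, Complex.ofReal_re,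
      Complex.mul_im, Complex.I_re, Complex.I_im, Complex.ofReal_im]
    field_simp
    ring

lemma arg_branchPoint (m : ℕ) {t : ℝ} (ht : t ∈ Set.Ioo 0 Real.pi) :
    (branchPoint m t).arg = Real.pi - t := by
  have hs := Real.sin_pos_of_mem_Ioo ht
  have := ht.1
  rw [branchPoint_eq m ht]
  exact Complex.arg_mul_cos_add_sin_mul_I (by positivity)
    ⟨by linarith [ht.2, Real.pi_pos], by linarith⟩

/-- The phase `Im z + arg z` is `(m + 1) π`, so the product is real, with a sign given by the parity
of `m + 1`. -/
lemma branchPoint_mul_exp (m : ℕ) {t : ℝ} (ht : t ∈ Set.Ioo 0 Real.pi) :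
    branchPoint m t * Complex.exp (branchPoint m t) =
      (((-1) ^ (m + 1) * Real.exp (branchLog m t) : ℝ) : ℂ) := by
  have hs := Real.sin_pos_of_mem_Ioo ht
  have ht0 := ht.1
  have hy : 0 < m * Real.pi + t := by positivity
  have hcos : Real.cos (m * Real.pi + t) = (-1) ^ m * Real.cos t := by
    rw [add_comm, Real.cos_add_nat_mul_pi]
  have hsin : Real.sin (m * Real.pi + t) = (-1) ^ m * Real.sin t := by
    rw [add_comm, Real.sin_add_nat_mul_pi]
  have hexp : Real.exp (branchLog m t) = (m * Real.pi + t) / Real.sin t *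
      Real.exp (-((m * Real.pi + t) * (Real.cos t / Real.sin t))) := by
    unfold branchLog
    rw [sub_eq_add_neg, Real.exp_add, Real.exp_sub, Real.exp_log hy, Real.exp_log hs]
  have hsc := Real.sin_sq_add_cos_sq t
  rw [hexp]
  refine Complex.ext ?_ ?_
  · rw [Complex.mul_re, Complex.exp_re, Complex.exp_im, Complex.ofReal_re]
    simp only [branchPoint]
    rw [hcos, hsin, pow_succ]
    field_simp
    rw [show Real.cos t ^ 2 = 1 - Real.sin t ^ 2 by linarith]
    ring
  · rw [Complex.mul_im, Complex.exp_re, Complex.exp_im, Complex.ofReal_im]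
    simp only [branchPoint]
    rw [hcos, hsin]
    field_simp
    ring

/-- A point of the upper half plane on the curve number `m` is a branch point. -/
lemma eq_branchPoint {m : ℕ} {z : ℂ} (hz : 0 < z.im) (h : z.im + z.arg = (m + 1) * Real.pi) :
    Real.pi - z.arg ∈ Set.Ioo 0 Real.pi ∧ z = branchPoint m (Real.pi - z.arg) := by
  have hz0 : z ≠ 0 := by
    rintro rfl
    simp at hz
  have hn : 0 < ‖z‖ := norm_pos_iff.2 hz0
  have hsin : Real.sin z.arg = z.im / ‖z‖ := Complex.sin_arg z
  have hcos : Real.cos z.arg = z.re / ‖z‖ := Complex.cos_arg hz0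
  have harg0 : 0 < z.arg := by
    refine lt_of_le_of_ne (Complex.arg_nonneg_iff.2 hz.le) fun h0 => ?_
    rw [← h0, Real.sin_zero] at hsin
    exact (div_pos hz hn).ne hsin
  have hargpi : z.arg < Real.pi := by
    refine lt_of_le_of_ne (Complex.arg_le_pi z) fun h0 => ?_
    rw [h0, Real.sin_pi] at hsin
    exact (div_pos hz hn).ne hsin
  refine ⟨⟨by linarith, by linarith⟩, ?_⟩
  have hy : m * Real.pi + (Real.pi - z.arg) = z.im := by linarith
  refine Complex.ext ?_ ?_
  · simp only [branchPoint]
    rw [hy, Real.cos_pi_sub, Real.sin_pi_sub, hsin, hcos]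
    field_simp
  · simp only [branchPoint]
    exact hy.symm

lemma exists_upper_root {w : ℝ} (hw : w ≠ 0) {m : ℕ} (hs : w = (-1) ^ (m + 1) * |w|)
    (h : 1 ≤ m ∨ w < -Real.exp (-1)) :
    ∃ z : ℂ, lambertChar w z = 0 ∧ 0 < z.im ∧ z.im + z.arg = (m + 1) * Real.pi := by
  have hwp : 0 < |w| := abs_pos.2 hw
  obtain ⟨t, ht, htw⟩ := exists_branchLog_eq m (c := Real.log |w|) (by
    refine h.imp id fun h => ?_
    rw [Real.lt_log_iff_exp_lt hwp]
    linarith [neg_le_abs w])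
  have ht0 := ht.1
  refine ⟨branchPoint m t, ?_, ?_, ?_⟩
  · rw [lambertChar_eq_zero_iff, branchPoint_mul_exp m ht, htw, Real.exp_log hwp, ← hs]
  · simp only [branchPoint]
    positivity
  · rw [arg_branchPoint m ht]
    simp only [branchPoint]
    ring

lemma branchLog_eq_of_root {w : ℝ} {m : ℕ} {t : ℝ} (ht : t ∈ Set.Ioo 0 Real.pi)
    (h : lambertChar w (branchPoint m t) = 0) : branchLog m t = Real.log |w| := by
  rw [lambertChar_eq_zero_iff, branchPoint_mul_exp m ht] at h
  have h1 : (-1) ^ (m + 1) * Real.exp (branchLog m t) = w := by exact_mod_cast h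
  rw [← h1, abs_mul, abs_pow, abs_neg, abs_one, one_pow, one_mul, abs_of_pos (Real.exp_pos _),
    Real.log_exp]

lemma upper_root_unique {w : ℝ} {m : ℕ} {z z' : ℂ} (hz : lambertChar w z = 0)
    (hz' : lambertChar w z' = 0) (hi : 0 < z.im) (hi' : 0 < z'.im)
    (h : z.im + z.arg = (m + 1) * Real.pi) (h' : z'.im + z'.arg = (m + 1) * Real.pi) :
    z = z' := by
  obtain ⟨ht, he⟩ := eq_branchPoint hi h
  obtain ⟨ht', he'⟩ := eq_branchPoint hi' h'
  have h1 := branchLog_eq_of_root ht (he ▸ hz)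
  have h2 := branchLog_eq_of_root ht' (he' ▸ hz')
  have h3 := (strictMonoOn_branchLog m).injOn ht ht' (h1.trans h2.symm)
  rw [he, he', h3]

lemma exp_neg_one_lt_abs_of_upper_root {w : ℝ} (hw : w ≠ 0) {z : ℂ} (hz : lambertChar w z = 0)
    (hi : 0 < z.im) (h : z.im + z.arg = Real.pi) : Real.exp (-1) < |w| := by
  obtain ⟨ht, he⟩ := eq_branchPoint (m := 0) hi (by simpa using h)
  have h1 := branchLog_eq_of_root ht (he ▸ hz)
  have h2 := neg_one_lt_branchLog_zero ht
  rw [h1, Real.lt_log_iff_exp_lt (abs_pos.2 hw)] at h2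
  exact h2

/-! ### Phases of the roots, and one root per branch. -/

lemma lambertChar_conj (w : ℝ) (z : ℂ) :
    lambertChar w (starRingEnd ℂ z) = starRingEnd ℂ (lambertChar w z) := by
  unfold lambertChar
  rw [map_sub, map_mul, Complex.exp_conj, Complex.conj_ofReal]

lemma lambertChar_conj_eq_zero {w : ℝ} {z : ℂ} (hz : lambertChar w z = 0) :
    lambertChar w (starRingEnd ℂ z) = 0 := by
  rw [lambertChar_conj, hz, map_zero]

lemma lambertChar_ofReal (w x : ℝ) : lambertChar w x = ((x * Real.exp x - w : ℝ) : ℂ) := by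
  unfold lambertChar
  push_cast
  rfl

lemma re_mul_exp_re_of_root {w : ℝ} {z : ℂ} (hz : lambertChar w z = 0) (hi : z.im = 0) :
    z.re * Real.exp z.re = w := by
  have h : z = (z.re : ℂ) := Complex.ext rfl (by simpa using hi)
  rw [h, lambertChar_ofReal] at hz
  exact sub_eq_zero.1 (by exact_mod_cast hz)

/-- The phase of a root is determined modulo `2π` by the sign of `w`. -/
lemma exists_phase {w : ℝ} (hw : w ≠ 0) {z : ℂ} (hz : lambertChar w z = 0) :
    (0 < w → ∃ n : ℤ, z.im + z.arg = 2 * n * Real.pi) ∧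
      (w < 0 → ∃ n : ℤ, z.im + z.arg = (2 * n + 1) * Real.pi) := by
  obtain ⟨hz0, -⟩ := exp_re_of_root hw hz
  -- In polar form `z e^z = r e^{iθ}`; being real and nonzero, it determines `θ` modulo `2π`.
  set r : ℝ := ‖z‖ * Real.exp z.re with hr
  have hr0 : 0 < r := mul_pos (norm_pos_iff.2 hz0) (Real.exp_pos _)
  set θ : ℝ := z.im + z.arg with hθ
  have hsin : Real.sin z.arg * ‖z‖ = z.im := by
    rw [Complex.sin_arg, div_mul_cancel₀ _ (norm_ne_zero_iff.2 hz0)]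
  have hcos : Real.cos z.arg * ‖z‖ = z.re := by
    rw [Complex.cos_arg hz0, div_mul_cancel₀ _ (norm_ne_zero_iff.2 hz0)]
  have h := lambertChar_eq_zero_iff.1 hz
  have hre : r * Real.cos θ = w := by
    have := congrArg Complex.re h
    rw [Complex.mul_re, Complex.exp_re, Complex.exp_im, Complex.ofReal_re] at this
    rw [hθ, Real.cos_add, hr, ← this]
    linear_combination Real.exp z.re * Real.cos z.im * hcos - Real.exp z.re * Real.sin z.im * hsin
  have him : r * Real.sin θ = 0 := by
    have := congrArg Complex.im h
    rw [Complex.mul_im, Complex.exp_re, Complex.exp_im, Complex.ofReal_im] at this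
    rw [hθ, Real.sin_add, hr, ← this]
    linear_combination Real.exp z.re * Real.sin z.im * hcos + Real.exp z.re * Real.cos z.im * hsin
  have hs0 : Real.sin θ = 0 := (mul_eq_zero.1 him).resolve_left hr0.ne'
  have hc := Real.sin_eq_zero_iff_cos_eq.1 hs0
  constructor
  · intro hw0
    have hc1 : Real.cos θ = 1 := by
      refine hc.resolve_right fun h1 => ?_
      rw [h1] at hre
      linarith
    obtain ⟨n, hn⟩ := (Real.cos_eq_one_iff θ).1 hc1
    exact ⟨n, by rw [← hn]; ring⟩
  · intro hw0
    have hc1 : Real.cos θ = -1 := by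
      refine hc.resolve_left fun h1 => ?_
      rw [h1] at hre
      linarith
    have hc2 : Real.cos (θ - Real.pi) = 1 := by rw [Real.cos_sub_pi, hc1, neg_neg]
    obtain ⟨n, hn⟩ := (Real.cos_eq_one_iff _).1 hc2
    exact ⟨n, by linarith⟩

/-- The phase is an even multiple of `π`, and the window of the branch contains just one, its
midpoint. -/
lemma mem_lambertRange_iff_of_pos {w : ℝ} (hw : 0 < w) {z : ℂ} (hz : lambertChar w z = 0) (k : ℤ) :
    z ∈ lambertRange k ↔ z.im + z.arg = 2 * k * Real.pi := by
  have hpi := Real.pi_pos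
  have hreal : ¬ (z.im = 0 ∧ z.re ≤ -1) := fun ⟨h1, h2⟩ => by
    have := re_mul_exp_re_of_root hz h1
    nlinarith [Real.exp_pos z.re]
  constructor
  · rintro (⟨-, h1, h2⟩ | ⟨-, h⟩)
    · obtain ⟨n, hn⟩ := (exists_phase hw.ne' hz).1 hw
      rw [hn] at h1 h2 ⊢
      have h3 := lt_of_mul_lt_mul_right h1 hpi.le
      have h4 := le_of_mul_le_mul_right h2 hpi
      have h5 : 2 * k - 1 < 2 * n := by exact_mod_cast h3
      have h6 : 2 * n ≤ 2 * k + 1 := by exact_mod_cast h4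
      have : n = k := by lia
      rw [this]
    · exact absurd h hreal
  · intro h
    refine Or.inl ⟨fun h' => hreal ⟨h'.1, h'.2.le⟩, ?_, ?_⟩ <;> rw [h] <;> nlinarith

/-- The phase is an odd multiple of `π`, and the half-open window contains just one, its closed
upper end. -/
lemma mem_lambertRange_iff_of_neg {w : ℝ} (hw : w < 0) {z : ℂ} (hz : lambertChar w z = 0) (k : ℤ) :
    z ∈ lambertRange k ↔ (¬ (z.im = 0 ∧ z.re < -1) ∧ z.im + z.arg = (2 * k + 1) * Real.pi) ∨
      (k = -1 ∧ z.im = 0 ∧ z.re ≤ -1) := by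
  have hpi := Real.pi_pos
  refine or_congr_left (and_congr_right fun _ => ⟨fun ⟨h1, h2⟩ => ?_, fun h => ⟨?_, h.le⟩⟩)
  · obtain ⟨n, hn⟩ := (exists_phase hw.ne hz).2 hw
    rw [hn] at h1 h2 ⊢
    have h3 := lt_of_mul_lt_mul_right h1 hpi.le
    have h4 := le_of_mul_le_mul_right h2 hpi
    have h5 : 2 * k - 1 < 2 * n + 1 := by exact_mod_cast h3
    have h6 : 2 * n + 1 ≤ 2 * k + 1 := by exact_mod_cast h4
    have : n = k := by lia
    rw [this]
  · rw [h]
    nlinarith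

lemma arg_conj_of_im_ne_zero {z : ℂ} (hi : z.im ≠ 0) : (starRingEnd ℂ z).arg = -z.arg := by
  rw [Complex.arg_conj, if_neg]
  intro h
  exact hi (Complex.arg_eq_pi_iff.1 h).2

lemma im_neg_of_phase_neg {z : ℂ} (h : z.im + z.arg < 0) : z.im < 0 := by
  by_contra! hi
  linarith [Complex.arg_nonneg_iff.2 hi]

lemma im_pos_of_pi_lt_phase {z : ℂ} (h : Real.pi < z.im + z.arg) : 0 < z.im := by
  linarith [Complex.arg_le_pi z]

lemma root_unique_of_phase_neg {w : ℝ} (m : ℕ) {z z' : ℂ} (hz : lambertChar w z = 0)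
    (hz' : lambertChar w z' = 0) (h : z.im + z.arg = -((m + 1) * Real.pi))
    (h' : z'.im + z'.arg = -((m + 1) * Real.pi)) : z = z' := by
  have hp : 0 < (m + 1) * Real.pi := by positivity
  have hi := im_neg_of_phase_neg (z := z) (by linarith)
  have hi' := im_neg_of_phase_neg (z := z') (by linarith)
  refine (starRingEnd ℂ).injective ?_
  refine upper_root_unique (m := m) (lambertChar_conj_eq_zero hz) (lambertChar_conj_eq_zero hz')
    (by simpa using hi) (by simpa using hi') ?_ ?_
  · rw [arg_conj_of_im_ne_zero hi.ne, Complex.conj_im]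
    linarith
  · rw [arg_conj_of_im_ne_zero hi'.ne, Complex.conj_im]
    linarith

lemma exists_lower_root {w : ℝ} (hw : w ≠ 0) {m : ℕ} (hs : w = (-1) ^ (m + 1) * |w|)
    (h : 1 ≤ m ∨ w < -Real.exp (-1)) :
    ∃ z : ℂ, lambertChar w z = 0 ∧ z.im < 0 ∧ z.im + z.arg = -((m + 1) * Real.pi) := by
  obtain ⟨z, hz, hi, hp⟩ := exists_upper_root hw hs h
  refine ⟨starRingEnd ℂ z, lambertChar_conj_eq_zero hz, by simpa using hi, ?_⟩
  rw [arg_conj_of_im_ne_zero hi.ne', Complex.conj_im]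
  linarith

lemma root_unique_of_pos {w : ℝ} (hw : 0 < w) {k : ℤ} {z z' : ℂ} (hz : lambertChar w z = 0)
    (hz' : lambertChar w z' = 0) (h : z.im + z.arg = 2 * k * Real.pi)
    (h' : z'.im + z'.arg = 2 * k * Real.pi) : z = z' := by
  have hpi := Real.pi_pos
  rcases lt_trichotomy k 0 with hk | rfl | hk
  · obtain ⟨m, hm⟩ : ∃ m : ℕ, (m : ℤ) + 1 = -(2 * k) := ⟨(-(2 * k) - 1).toNat, by lia⟩
    have hm' : (m : ℝ) + 1 = -(2 * k) := by exact_mod_cast hm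
    exact root_unique_of_phase_neg m hz hz' (by rw [h, hm']; ring) (by rw [h', hm']; ring)
  · have key : ∀ z : ℂ, lambertChar w z = 0 → z.im + z.arg = 2 * ((0 : ℤ) : ℝ) * Real.pi →
        z.im = 0 ∧ 0 ≤ z.re := by
      intro z hz h
      rw [Int.cast_zero, mul_zero, zero_mul] at h
      have hi : z.im = 0 := by
        rcases lt_trichotomy z.im 0 with hi | hi | hi
        · linarith [Complex.arg_neg_iff.2 hi]
        · exact hi
        · linarith [Complex.arg_nonneg_iff.2 hi.le]
      have := re_mul_exp_re_of_root hz hi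
      exact ⟨hi, by nlinarith [Real.exp_pos z.re]⟩
    obtain ⟨hi, hr⟩ := key z hz h
    obtain ⟨hi', hr'⟩ := key z' hz' h'
    refine Complex.ext ?_ (hi.trans hi'.symm)
    refine strictMonoOn_mul_exp.injOn (by simp only [Set.mem_Ici]; linarith)
      (by simp only [Set.mem_Ici]; linarith) ?_
    exact (re_mul_exp_re_of_root hz hi).trans (re_mul_exp_re_of_root hz' hi').symm
  · obtain ⟨m, hm⟩ : ∃ m : ℕ, (m : ℤ) + 1 = 2 * k := ⟨(2 * k - 1).toNat, by lia⟩
    have hm' : (m : ℝ) + 1 = 2 * k := by exact_mod_cast hm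
    have hk1 : (1 : ℝ) ≤ k := by exact_mod_cast hk
    exact upper_root_unique (m := m) hz hz' (im_pos_of_pi_lt_phase (by nlinarith))
      (im_pos_of_pi_lt_phase (by nlinarith)) (by rw [h, hm']) (by rw [h', hm'])

/-- The roots in the range of `W₀`, for negative `w`. -/
lemma root_cases_of_phase_pi {w : ℝ} (hw : w < 0) {z : ℂ} (hz : lambertChar w z = 0)
    (hr : ¬ (z.im = 0 ∧ z.re < -1)) (h : z.im + z.arg = Real.pi) :
    (0 < z.im ∧ w < -Real.exp (-1)) ∨ (z.im = 0 ∧ -1 ≤ z.re ∧ -Real.exp (-1) ≤ w) := by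
  rcases lt_trichotomy z.im 0 with hi | hi | hi
  · linarith [Complex.arg_neg_iff.2 hi, Real.pi_pos]
  · refine Or.inr ⟨hi, not_lt.1 fun h' => hr ⟨hi, h'⟩, ?_⟩
    rw [← re_mul_exp_re_of_root hz hi]
    exact neg_exp_neg_one_le_mul_exp _
  · refine Or.inl ⟨hi, ?_⟩
    have := exp_neg_one_lt_abs_of_upper_root hw.ne hz hi h
    rw [abs_of_neg hw] at this
    linarith

lemma root_unique_of_neg {w : ℝ} (hw : w < 0) {k : ℤ} {z z' : ℂ} (hz : lambertChar w z = 0)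
    (hz' : lambertChar w z' = 0) (hr : ¬ (z.im = 0 ∧ z.re < -1))
    (hr' : ¬ (z'.im = 0 ∧ z'.re < -1)) (h : z.im + z.arg = (2 * k + 1) * Real.pi)
    (h' : z'.im + z'.arg = (2 * k + 1) * Real.pi) : z = z' := by
  have hpi := Real.pi_pos
  rcases lt_trichotomy k 0 with hk | rfl | hk
  · obtain ⟨m, hm⟩ : ∃ m : ℕ, (m : ℤ) + 1 = -(2 * k + 1) := ⟨(-(2 * k + 1) - 1).toNat, by lia⟩
    have hm' : (m : ℝ) + 1 = -(2 * k + 1) := by exact_mod_cast hm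
    exact root_unique_of_phase_neg m hz hz' (by rw [h, hm']; ring) (by rw [h', hm']; ring)
  · simp only [Int.cast_zero, mul_zero, zero_add, one_mul] at h h'
    rcases root_cases_of_phase_pi hw hz hr h with ⟨hi, h1⟩ | ⟨hi, h1, h2⟩ <;>
    rcases root_cases_of_phase_pi hw hz' hr' h' with ⟨hi', h1'⟩ | ⟨hi', h1', h2'⟩
    · exact upper_root_unique (m := 0) hz hz' hi hi' (by simpa using h) (by simpa using h')
    · linarith
    · linarith
    · refine Complex.ext ?_ (hi.trans hi'.symm)
      refine strictMonoOn_mul_exp.injOn h1 h1' ?_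
      exact (re_mul_exp_re_of_root hz hi).trans (re_mul_exp_re_of_root hz' hi').symm
  · obtain ⟨m, hm⟩ : ∃ m : ℕ, (m : ℤ) + 1 = 2 * k + 1 := ⟨(2 * k).toNat, by lia⟩
    have hm' : (m : ℝ) + 1 = 2 * k + 1 := by exact_mod_cast hm
    have hk1 : (1 : ℝ) ≤ k := by exact_mod_cast hk
    exact upper_root_unique (m := m) hz hz' (im_pos_of_pi_lt_phase (by nlinarith))
      (im_pos_of_pi_lt_phase (by nlinarith)) (by rw [h, hm']) (by rw [h', hm'])

lemma root_unique {w : ℝ} (hw : w ≠ 0) {k : ℤ} {z z' : ℂ} (hz : lambertChar w z = 0)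
    (hz' : lambertChar w z' = 0) (h : z ∈ lambertRange k) (h' : z' ∈ lambertRange k) : z = z' := by
  rcases lt_or_gt_of_ne hw with hw | hw
  · rw [mem_lambertRange_iff_of_neg hw hz] at h
    rw [mem_lambertRange_iff_of_neg hw hz'] at h'
    -- The two alternatives for `W_{-1}` exclude each other: a root of phase `-π` needs `w < -1/e`,
    -- a real root needs `w ≥ -1/e`.
    have mixed : ∀ z z' : ℂ, lambertChar w z = 0 → lambertChar w z' = 0 →
        z.im + z.arg = (2 * ((-1 : ℤ) : ℝ) + 1) * Real.pi → z'.im = 0 → False := by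
      intro z z' hz hz' h hi'
      have hp : z.im + z.arg = -Real.pi := by rw [h]; push_cast; ring
      have hi := im_neg_of_phase_neg (z := z) (by linarith [Real.pi_pos])
      have h1 := exp_neg_one_lt_abs_of_upper_root hw.ne (lambertChar_conj_eq_zero hz)
        (by simpa using hi)
        (by rw [arg_conj_of_im_ne_zero hi.ne, Complex.conj_im]; linarith)
      have h2 := neg_exp_neg_one_le_mul_exp z'.re
      rw [re_mul_exp_re_of_root hz' hi'] at h2
      rw [abs_of_neg hw] at h1
      linarith
    rcases h with ⟨hr, h⟩ | ⟨rfl, hi, hr⟩ <;> rcases h' with ⟨hr', h'⟩ | ⟨hk, hi', hr'⟩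
    · exact root_unique_of_neg hw hz hz' hr hr' h h'
    · subst hk
      exact (mixed z z' hz hz' h hi').elim
    · exact (mixed z' z hz' hz h' hi).elim
    · refine Complex.ext ?_ (hi.trans hi'.symm)
      refine strictAntiOn_mul_exp.injOn hr hr' ?_
      exact (re_mul_exp_re_of_root hz hi).trans (re_mul_exp_re_of_root hz' hi').symm
  · rw [mem_lambertRange_iff_of_pos hw hz] at h
    rw [mem_lambertRange_iff_of_pos hw hz'] at h'
    exact root_unique_of_pos hw hz hz' h h'

lemma exists_root_of_pos {w : ℝ} (hw : 0 < w) (k : ℤ) :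
    ∃ z, lambertChar w z = 0 ∧ z.im + z.arg = 2 * k * Real.pi := by
  rcases lt_trichotomy k 0 with hk | rfl | hk
  · obtain ⟨m, hm⟩ : ∃ m : ℕ, (m : ℤ) + 1 = -(2 * k) := ⟨(-(2 * k) - 1).toNat, by lia⟩
    have hm' : (m : ℝ) + 1 = -(2 * k) := by exact_mod_cast hm
    have he : Even (m + 1) := by
      rw [← Int.even_coe_nat]
      exact ⟨-k, by push_cast; lia⟩
    obtain ⟨z, hz, -, hp⟩ := exists_lower_root hw.ne' (m := m)
      (by rw [he.neg_one_pow, one_mul, abs_of_pos hw]) (Or.inl (by lia))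
    exact ⟨z, hz, by rw [hp, hm']; ring⟩
  · obtain ⟨x, hx, hxw⟩ := exists_pos_mul_exp_eq hw
    refine ⟨x, by rw [lambertChar_ofReal, hxw]; simp, ?_⟩
    rw [Complex.arg_ofReal_of_nonneg hx.le]
    simp
  · obtain ⟨m, hm⟩ : ∃ m : ℕ, (m : ℤ) + 1 = 2 * k := ⟨(2 * k - 1).toNat, by lia⟩
    have hm' : (m : ℝ) + 1 = 2 * k := by exact_mod_cast hm
    have he : Even (m + 1) := by
      rw [← Int.even_coe_nat]
      exact ⟨k, by push_cast; lia⟩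
    obtain ⟨z, hz, -, hp⟩ := exists_upper_root hw.ne' (m := m)
      (by rw [he.neg_one_pow, one_mul, abs_of_pos hw]) (Or.inl (by lia))
    exact ⟨z, hz, by rw [hp, hm']⟩

lemma exists_root_of_neg {w : ℝ} (hw : w < 0) (k : ℤ) :
    ∃ z, lambertChar w z = 0 ∧
      ((¬ (z.im = 0 ∧ z.re < -1) ∧ z.im + z.arg = (2 * k + 1) * Real.pi) ∨
        (k = -1 ∧ z.im = 0 ∧ z.re ≤ -1)) := by
  -- In this case the root is real: the one in `[-1, 0)` goes to `W_0`, the one in `(-∞, -1]` to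
  -- `W_{-1}`.
  by_cases hk : (k = 0 ∨ k = -1) ∧ -Real.exp (-1) ≤ w
  · obtain ⟨rfl | rfl, hw1⟩ := hk
    · obtain ⟨x, hx, hx0, hxw⟩ := exists_mem_Ico_mul_exp_eq hw hw1
      refine ⟨x, by rw [lambertChar_ofReal, hxw]; simp, Or.inl ⟨fun h => ?_, ?_⟩⟩
      · exact absurd h.2 (by simpa using hx)
      · rw [Complex.arg_ofReal_of_neg hx0]
        simp
    · obtain ⟨x, hx, hxw⟩ := exists_le_neg_one_mul_exp_eq hw hw1
      exact ⟨x, by rw [lambertChar_ofReal, hxw]; simp, Or.inr ⟨rfl, by simp, by simpa using hx⟩⟩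
  · have hk' : (k ≠ 0 ∧ k ≠ -1) ∨ w < -Real.exp (-1) := by
      by_contra! h
      exact hk ⟨by by_cases hk0 : k = 0 <;> simp_all, h.2⟩
    rcases lt_or_ge k 0 with hk | hk
    · obtain ⟨m, hm⟩ : ∃ m : ℕ, (m : ℤ) + 1 = -(2 * k + 1) := ⟨(-(2 * k + 1) - 1).toNat, by lia⟩
      have hm' : (m : ℝ) + 1 = -(2 * k + 1) := by exact_mod_cast hm
      have he : Odd (m + 1) := by
        rw [← Int.odd_coe_nat]
        exact ⟨-k - 1, by push_cast; lia⟩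
      obtain ⟨z, hz, hi, hp⟩ := exists_lower_root hw.ne (m := m)
        (by rw [he.neg_one_pow, abs_of_neg hw]; ring) (hk'.imp_left (by lia))
      exact ⟨z, hz, Or.inl ⟨fun h => hi.ne h.1, by rw [hp, hm']; ring⟩⟩
    · obtain ⟨m, hm⟩ : ∃ m : ℕ, (m : ℤ) + 1 = 2 * k + 1 := ⟨(2 * k).toNat, by lia⟩
      have hm' : (m : ℝ) + 1 = 2 * k + 1 := by exact_mod_cast hm
      have he : Odd (m + 1) := by
        rw [← Int.odd_coe_nat]
        exact ⟨k, by push_cast; lia⟩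
      obtain ⟨z, hz, hi, hp⟩ := exists_upper_root hw.ne (m := m)
        (by rw [he.neg_one_pow, abs_of_neg hw]; ring) (hk'.imp_left (by lia))
      exact ⟨z, hz, Or.inl ⟨fun h => hi.ne' h.1, by rw [hp, hm']⟩⟩

/-! ### The Lambert branches as an enumeration of the roots, and their conjugation symmetry. -/

lemma lambertW_spec {w : ℝ} (hw : w ≠ 0) (k : ℤ) :
    lambertW k w ∈ lambertRange k ∧ lambertChar w (lambertW k w) = 0 := by
  have hex : ∃ z : ℂ, z ∈ lambertRange k ∧ z * Complex.exp z = w := by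
    rcases lt_or_gt_of_ne hw with h | h
    · obtain ⟨z, hz, hp⟩ := exists_root_of_neg h k
      exact ⟨z, (mem_lambertRange_iff_of_neg h hz k).2 hp, lambertChar_eq_zero_iff.1 hz⟩
    · obtain ⟨z, hz, hp⟩ := exists_root_of_pos h k
      exact ⟨z, (mem_lambertRange_iff_of_pos h hz k).2 hp, lambertChar_eq_zero_iff.1 hz⟩
  have := Classical.epsilon_spec hex
  exact ⟨this.1, lambertChar_eq_zero_iff.2 this.2⟩

lemma eq_lambertW {w : ℝ} (hw : w ≠ 0) {k : ℤ} {z : ℂ} (hz : lambertChar w z = 0)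
    (h : z ∈ lambertRange k) : z = lambertW k w :=
  root_unique hw hz (lambertW_spec hw k).2 h (lambertW_spec hw k).1

/-- Since `|arg z| ≤ π`, the phase window gives `|Im z| ≥ (2|k| - 2) π` for `k ≠ 0`, apart from the
real ray of `W_{-1}`. -/
lemma abs_le_norm_add_one_of_mem_lambertRange {k : ℤ} {z : ℂ} (h : z ∈ lambertRange k) :
    |(k : ℝ)| ≤ ‖z‖ + 1 := by
  have hpi := Real.pi_gt_three
  rcases h with ⟨-, h1, h2⟩ | ⟨rfl, -⟩
  · have hi := Complex.abs_im_le_norm z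
    have h3 := Complex.arg_le_pi z
    have h4 := Complex.neg_pi_lt_arg z
    rw [abs_le] at hi
    rcases lt_trichotomy k 0 with hk | rfl | hk
    · have hk1 : (k : ℝ) ≤ -1 := by exact_mod_cast Int.le_sub_one_of_lt hk
      rw [abs_of_neg (by linarith)]
      nlinarith
    · simp
      positivity
    · have hk1 : (1 : ℝ) ≤ k := by exact_mod_cast hk
      rw [abs_of_pos (by linarith)]
      nlinarith
  · simp

/-- Only the branch point value `-1` is taken by two branches. -/
lemma eq_of_mem_lambertRange {i j : ℤ} {z : ℂ} (hi : z ∈ lambertRange i)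
    (hj : z ∈ lambertRange j) (hz : z ≠ -1) : i = j := by
  have hpi := Real.pi_pos
  have mixed : ¬ (z.im = 0 ∧ z.re < -1) → z.im = 0 ∧ z.re ≤ -1 → False := fun h1 h2 =>
    hz (Complex.ext (by simpa using le_antisymm h2.2 (not_lt.1 fun h => h1 ⟨h2.1, h⟩))
      (by simpa using h2.1))
  rcases hi with ⟨h, h1, h2⟩ | ⟨hi, h⟩ <;> rcases hj with ⟨h', h1', h2'⟩ | ⟨hj, h'⟩
  · have h3 := lt_of_mul_lt_mul_right (h1.trans_le h2') hpi.le
    have h4 := lt_of_mul_lt_mul_right (h1'.trans_le h2) hpi.le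
    have h5 : 2 * i - 1 < 2 * j + 1 := by exact_mod_cast h3
    have h6 : 2 * j - 1 < 2 * i + 1 := by exact_mod_cast h4
    lia
  · exact (mixed h h').elim
  · exact (mixed h' h).elim
  · rw [hi, hj]

lemma exists_eq_lambertW {w : ℝ} (hw : w ≠ 0) {z : ℂ} (hz : lambertChar w z = 0) :
    ∃ k : ℤ, lambertW k w = z := by
  suffices h : ∃ k : ℤ, z ∈ lambertRange k by
    obtain ⟨k, hk⟩ := h
    exact ⟨k, (eq_lambertW hw hz hk).symm⟩
  rcases lt_or_gt_of_ne hw with h | h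
  · by_cases hr : z.im = 0 ∧ z.re < -1
    · exact ⟨-1, Or.inr ⟨rfl, hr.1, hr.2.le⟩⟩
    · obtain ⟨n, hn⟩ := (exists_phase hw hz).2 h
      exact ⟨n, (mem_lambertRange_iff_of_neg h hz n).2 (Or.inl ⟨hr, hn⟩)⟩
  · obtain ⟨n, hn⟩ := (exists_phase hw hz).1 h
    exact ⟨n, (mem_lambertRange_iff_of_pos h hz n).2 hn⟩

theorem isRootEnumeration_lambertW {w : ℝ} (hw : w ≠ 0) :
    IsRootEnumeration w (fun k => lambertW k w) where
  root k := (lambertW_spec hw k).2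
  surj _ hz := exists_eq_lambertW hw hz
  inj i j h hne := eq_of_mem_lambertRange (lambertW_spec hw i).1
    (by rw [h]; exact (lambertW_spec hw j).1) hne
  growth k := abs_le_norm_add_one_of_mem_lambertRange (lambertW_spec hw k).1

lemma lambertW_neg_eq_conj {w : ℝ} (hw : 0 < w) (k : ℤ) :
    lambertW (-k) w = starRingEnd ℂ (lambertW k w) := by
  obtain ⟨hr, hz⟩ := lambertW_spec hw.ne' k
  refine (eq_lambertW hw.ne' (lambertChar_conj_eq_zero hz) ?_).symm
  rw [mem_lambertRange_iff_of_pos hw hz] at hr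
  rw [mem_lambertRange_iff_of_pos hw (lambertChar_conj_eq_zero hz)]
  set z := lambertW k w
  by_cases hi : z.im = 0
  · have h := re_mul_exp_re_of_root hz hi
    have hre : 0 < z.re := by
      by_contra! hle
      nlinarith [Real.exp_pos z.re]
    have harg : z.arg = 0 := Complex.arg_eq_zero_iff.2 ⟨hre.le, hi⟩
    rw [Complex.conj_im, Complex.arg_conj, harg, if_neg Real.pi_pos.ne]
    rw [harg] at hr
    push_cast
    linarith
  · rw [arg_conj_of_im_ne_zero hi, Complex.conj_im]
    push_cast
    linarith

/-- Conjugation reverses the phase of a nonreal root, and `-(2k + 1) = 2(-k - 1) + 1`. Real negative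
roots are excluded because their argument stays `π`. -/
lemma lambertW_neg_sub_one_eq_conj {w : ℝ} (hw : w < 0) {k : ℤ} (hi : (lambertW k w).im ≠ 0) :
    lambertW (-k - 1) w = starRingEnd ℂ (lambertW k w) := by
  obtain ⟨hr, hz⟩ := lambertW_spec hw.ne k
  refine (eq_lambertW hw.ne (lambertChar_conj_eq_zero hz) ?_).symm
  rw [mem_lambertRange_iff_of_neg hw hz] at hr
  rw [mem_lambertRange_iff_of_neg hw (lambertChar_conj_eq_zero hz)]
  set z := lambertW k w
  rcases hr with ⟨-, hr⟩ | ⟨-, hr, -⟩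
  · refine Or.inl ⟨fun h => hi (by simpa using h.1), ?_⟩
    rw [arg_conj_of_im_ne_zero hi, Complex.conj_im]
    push_cast
    linarith
  · exact absurd hr hi

lemma lambertW_im_ne_zero {w : ℝ} (hw : w < 0) {k : ℤ} (hk : 1 ≤ k) : (lambertW k w).im ≠ 0 := by
  obtain ⟨hr, hz⟩ := lambertW_spec hw.ne k
  have hk1 : (1 : ℝ) ≤ k := by exact_mod_cast hk
  have hpi := Real.pi_pos
  rw [mem_lambertRange_iff_of_neg hw hz] at hr
  rcases hr with ⟨-, hr⟩ | ⟨hr, -⟩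
  · exact (im_pos_of_pi_lt_phase (by rw [hr]; nlinarith)).ne'
  · lia

lemma lambertW_neg_exp_neg_one :
    lambertW 0 ((-Real.exp (-1) : ℝ) : ℂ) = -1 ∧ lambertW (-1) ((-Real.exp (-1) : ℝ) : ℂ) = -1 := by
  have hw : -Real.exp (-1) < 0 := neg_neg_of_pos (Real.exp_pos _)
  have hz : lambertChar (-Real.exp (-1)) (-1) = 0 := by
    rw [lambertChar_eq_zero_iff]
    simp
  refine ⟨(eq_lambertW hw.ne hz ?_).symm, (eq_lambertW hw.ne hz ?_).symm⟩
  · rw [mem_lambertRange_iff_of_neg hw hz]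
    simp
  · exact Or.inr (by simp)

lemma lambertChar_neg_one_eq_zero_iff {w : ℝ} :
    lambertChar w (-1) = 0 ↔ w = -Real.exp (-1) := by
  have h := lambertChar_ofReal w (-1)
  rw [Complex.ofReal_neg, Complex.ofReal_one] at h
  rw [h, Complex.ofReal_eq_zero, sub_eq_zero, neg_one_mul]
  exact eq_comm

/-! ### Real modes -/

lemma realMode_eq_re (c μ : ℂ) (s : ℝ) :
    (c * Complex.exp (μ * s)).re = realMode μ c.re (-c.im) s := by
  unfold realMode
  rw [Complex.mul_re, Complex.exp_re, Complex.exp_im, Complex.re_mul_ofReal, Complex.im_mul_ofReal]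
  ring

lemma realMode_conj (μ : ℂ) (A B s : ℝ) :
    realMode (starRingEnd ℂ μ) A B s = realMode μ A (-B) s := by
  unfold realMode
  rw [Complex.conj_re, Complex.conj_im, neg_mul, Real.cos_neg, Real.sin_neg]
  ring

lemma realMode_add (μ : ℂ) (A B A' B' s : ℝ) :
    realMode μ A B s + realMode μ A' B' s = realMode μ (A + A') (B + B') s := by
  unfold realMode
  ring

lemma realMode_of_im_eq_zero {μ : ℂ} (h : μ.im = 0) (A B s : ℝ) :
    realMode μ A B s = A * Real.exp (μ.re * s) := by
  unfold realMode
  rw [h, zero_mul, Real.cos_zero, Real.sin_zero]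
  ring

/-- Expansion into real modes for positive `w`. -/
lemma exists_real_expansion_of_pos {w : ℝ} (hw : 0 < w) {c : ℤ → ℂ} {g : ℝ → ℝ}
    (h : ∀ s, HasSum (fun k : ℤ => realMode (lambertW k w) (c k).re (-(c k).im) s) (g s)) :
    ∃ A B : ℕ → ℝ, ∀ s, HasSum (fun k : ℕ => realMode (lambertW k w) (A k) (B k) s) (g s) := by
  refine ⟨fun n => (c n).re + if n = 0 then 0 else (c (-n)).re,
    fun n => -(c n).im + if n = 0 then 0 else (c (-n)).im, fun s => ?_⟩
  -- Pairing `n` with `-n` counts the index `0` twice; one copy is removed.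
  have h1 := (h s).nat_add_neg.sub
    (hasSum_ite_eq (0 : ℕ) (realMode (lambertW 0 w) (c 0).re (-(c 0).im) s))
  rw [add_sub_cancel_right] at h1
  refine h1.congr_fun fun n => ?_
  by_cases hn : n = 0
  · subst hn
    simp
  · simp only [hn, if_false, sub_zero]
    rw [lambertW_neg_eq_conj hw, realMode_conj, realMode_add, neg_neg]

/-- Expansion into real modes for negative `w`. -/
lemma exists_real_expansion_of_neg {w : ℝ} (hw : w < 0) {c : ℤ → ℂ} {g : ℝ → ℝ}
    (h : ∀ s, HasSum (fun k : ℤ => realMode (lambertW k w) (c k).re (-(c k).im) s) (g s)) :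
    ∃ A B : ℕ → ℝ, ∃ A' : ℝ, (A' ≠ 0 → (lambertW (-1) w).im = 0 ∧ A' = (c (-1)).re) ∧
      ∀ s, HasSum (fun k : ℕ => realMode (lambertW k w) (A k) (B k) s)
        (g s - A' * Real.exp ((lambertW (-1) w).re * s)) := by
  have hfold : ∀ n : ℕ, (lambertW n w).im ≠ 0 → ∀ s,
      realMode (lambertW n w) (c n).re (-(c n).im) s +
        realMode (lambertW (-(n + 1)) w) (c (-(n + 1))).re (-(c (-(n + 1))).im) s =
      realMode (lambertW n w) ((c n).re + (c (-(n + 1))).re)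
        (-(c n).im + (c (-(n + 1))).im) s := by
    intro n hn s
    have h1 := lambertW_neg_sub_one_eq_conj hw hn
    rw [show -(n : ℤ) - 1 = -(n + 1) by ring] at h1
    rw [h1, realMode_conj, realMode_add, neg_neg]
  by_cases him : (lambertW (-1) w).im = 0
  · refine ⟨fun n => (c n).re + if n = 0 then 0 else (c (-(n + 1))).re,
      fun n => -(c n).im + if n = 0 then 0 else (c (-(n + 1))).im, (c (-1)).re,
      fun _ => ⟨him, rfl⟩, fun s => ?_⟩
    rw [← realMode_of_im_eq_zero him _ (-(c (-1)).im)]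
    have h1 := (h s).nat_add_neg_add_one.sub
      (hasSum_ite_eq (0 : ℕ) (realMode (lambertW (-1) w) (c (-1)).re (-(c (-1)).im) s))
    refine h1.congr_fun fun n => ?_
    by_cases hn : n = 0
    · subst hn
      simp
    · simp only [hn, if_false, sub_zero]
      rw [hfold n (lambertW_im_ne_zero hw (by lia))]
  · refine ⟨fun n => (c n).re + (c (-(n + 1))).re, fun n => -(c n).im + (c (-(n + 1))).im, 0,
      by simp, fun s => ?_⟩
    rw [zero_mul, sub_zero]
    refine (h s).nat_add_neg_add_one.congr_fun fun n => ?_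
    refine (hfold n ?_ s).symm
    rcases Nat.eq_zero_or_pos n with rfl | hn
    · have h1 := lambertW_neg_sub_one_eq_conj hw him
      rw [show -(-1 : ℤ) - 1 = ((0 : ℕ) : ℤ) by norm_num] at h1
      rw [h1]
      simpa using him
    · exact lambertW_im_ne_zero hw (by lia)

theorem exists_real_expansion {w : ℝ} (hw : w ≠ 0) {g : ℝ → ℝ}
    (hg : IsDelaySolution w (fun s => (g s : ℂ))) :
    ∃ (A B : ℕ → ℝ) (A' : ℝ), (A' ≠ 0 → (lambertW (-1) w).im = 0) ∧
      ∀ s : ℝ, HasSum (fun k : ℕ => realMode (lambertW k w) (A k) (B k) s)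
        (g s - A' * ((if w = -Real.exp (-1) then s else 1) *
          Real.exp ((lambertW (-1) w).re * s))) := by
  obtain ⟨c, c₀, c₁, h0, hc, hsum⟩ := exists_hasSum_modes hw (isRootEnumeration_lambertW hw) hg
  have hre : ∀ s : ℝ, HasSum (fun k : ℤ => realMode (lambertW k w) (c k).re (-(c k).im) s)
      (g s - (c₀.re * Real.exp (-s) + c₁.re * (s * Real.exp (-s)))) := by
    intro s
    have h1 := Complex.reCLM.hasSum (hsum s)
    have h2 : (c₀ * Complex.exp (-1 * s) + c₁ * (s * Complex.exp (-1 * s))).re =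
        c₀.re * Real.exp (-s) + c₁.re * (s * Real.exp (-s)) := by
      have : Complex.exp (-1 * s) = (Real.exp (-s) : ℝ) := by
        push_cast
        ring_nf
      rw [this, ← Complex.ofReal_mul, Complex.add_re, Complex.re_mul_ofReal, Complex.re_mul_ofReal]
    rw [Complex.reCLM_apply, Complex.sub_re, Complex.ofReal_re, h2] at h1
    refine h1.congr_fun fun k => ?_
    exact (realMode_eq_re _ _ _).symm
  by_cases hw1 : w = -Real.exp (-1)
  · have hneg : w < 0 := by
      rw [hw1]
      exact neg_neg_of_pos (Real.exp_pos _)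
    obtain ⟨hW0, hW1⟩ := lambertW_neg_exp_neg_one
    rw [← hw1] at hW0 hW1
    obtain ⟨A, B, A', hA', h⟩ := exists_real_expansion_of_neg hneg hre
    -- At the branch point the index `-1` has root `-1` and thus coefficient `0`. The extra mode is
    -- free for `c₁ s e^{-s}`, while `c₀ e^{-s}` is absorbed into the mode of index `0`.
    have hA0 : A' = 0 := by
      by_contra hne
      refine hne ((hA' hne).2.trans ?_)
      rw [hc (-1) hW1, Complex.zero_re]
    refine ⟨fun n => A n + if n = 0 then c₀.re else 0, B, c₁.re, fun _ => by rw [hW1]; simp,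
      fun s => ?_⟩
    have h2 := (h s).add (hasSum_ite_eq (0 : ℕ) (c₀.re * Real.exp (-s)))
    rw [hA0, zero_mul, sub_zero] at h2
    rw [if_pos hw1, hW1]
    convert! h2.congr_fun fun n => ?_ using 1
    · simp
      ring
    · by_cases hn : n = 0
      · subst hn
        have : realMode (lambertW 0 w) c₀.re 0 s = c₀.re * Real.exp (-s) := by
          rw [realMode_of_im_eq_zero (by rw [hW0]; simp), hW0]
          simp
        simp only [Nat.cast_zero, if_true]
        rw [← this, realMode_add, add_zero]
      · simp [hn]
  · obtain ⟨rfl, rfl⟩ := h0 fun h => hw1 (lambertChar_neg_one_eq_zero_iff.1 h)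
    simp only [Complex.zero_re, zero_mul, add_zero, sub_zero] at hre
    simp only [if_neg hw1, one_mul]
    rcases lt_or_gt_of_ne hw with hneg | hpos
    · obtain ⟨A, B, A', hA', h⟩ := exists_real_expansion_of_neg hneg hre
      exact ⟨A, B, A', fun hne => (hA' hne).1, h⟩
    · obtain ⟨A, B, h⟩ := exists_real_expansion_of_pos hpos hre
      exact ⟨A, B, 0, by simp, by simpa using h⟩

/-! ### The delay equation of a curve similar to its skew-evolute -/

lemma unitTangent_re (θ : ℝ) : (unitTangent θ).re = Real.cos θ := Complex.exp_ofReal_mul_I_re θ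

lemma unitTangent_im (θ : ℝ) : (unitTangent θ).im = Real.sin θ := Complex.exp_ofReal_mul_I_im θ

lemma tiltedRay_re (φ θ : ℝ) : (tiltedRay φ θ).re = -Real.sin (θ - φ) := by
  rw [Real.sin_sub]
  simp only [tiltedRay, unitNormal, Complex.add_re, Complex.mul_re, Complex.mul_im,
    Complex.ofReal_re, Complex.ofReal_im, Complex.I_re, Complex.I_im, unitTangent_re,
    unitTangent_im]
  ring

lemma tiltedRay_im (φ θ : ℝ) : (tiltedRay φ θ).im = Real.cos (θ - φ) := by
  rw [Real.cos_sub]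
  simp only [tiltedRay, unitNormal, Complex.add_im, Complex.mul_re, Complex.mul_im,
    Complex.ofReal_re, Complex.ofReal_im, Complex.I_re, Complex.I_im, unitTangent_re,
    unitTangent_im]
  ring

lemma tiltedRay_eq_unitTangent (φ θ : ℝ) :
    tiltedRay φ θ = unitTangent (θ + Real.pi / 2 - φ) := by
  refine Complex.ext ?_ ?_
  · rw [tiltedRay_re, unitTangent_re, add_sub_right_comm, Real.cos_add_pi_div_two]
  · rw [tiltedRay_im, unitTangent_im, add_sub_right_comm, Real.sin_add_pi_div_two]

lemma hasDerivAt_tiltedRay (φ θ : ℝ) :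
    HasDerivAt (tiltedRay φ) (Complex.I * tiltedRay φ θ) θ := by
  have h : HasDerivAt unitTangent (Complex.I * unitTangent θ) θ := by
    have h1 := hasDerivAt_exp_mul_ofReal Complex.I θ
    have h2 : unitTangent = fun s : ℝ => Complex.exp (Complex.I * s) := by
      funext s
      rw [unitTangent, mul_comm]
    rw [h2]
    exact h1
  have h2 := (h.const_mul (Real.sin φ : ℂ)).add
    ((h.const_mul Complex.I).const_mul (Real.cos φ : ℂ))
  refine h2.congr_deriv ?_
  unfold tiltedRay unitNormal
  ring

/-- The envelope condition forces `t = R cos φ`. As `T = sin φ ν - cos φ iν`, the `iν` components of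
the derivative cancel, and the `ν` component is `cos φ R' + sin φ R`, to be compared with `R₁(θ₁)`.
-/
theorem delay_equation_of_similar {φ a α : ℝ} {R : ℝ → ℝ}
    (hR : SimilarToSkewEvoluteWithDelay φ a α R) (θ : ℝ) :
    Real.cos φ * deriv R θ + Real.sin φ * R θ = a * R (θ - α) := by
  obtain ⟨-, r, c, R₁, β, hr, hc, hc', hsim, hα⟩ := hR
  have hrd : ∀ θ, HasDerivAt r ((R θ : ℂ) * unitTangent θ) θ := fun θ => by
    simpa using hr.2 θ
  have hcd : HasDerivAt c ((R₁ (θ + Real.pi / 2 - φ) : ℂ) * tiltedRay φ θ) θ := by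
    have h1 := hc'.2 θ
    have h2 : deriv (fun θ : ℝ => θ + Real.pi / 2 - φ) θ = 1 := by simp
    rw [h2, mul_one, ← tiltedRay_eq_unitTangent] at h1
    exact h1
  have hcr : c = fun θ => r θ + ((R θ * Real.cos φ : ℝ) : ℂ) * tiltedRay φ θ := by
    funext θ
    obtain ⟨t, ht, hcross⟩ := hc θ
    rw [(hrd θ).deriv, (hasDerivAt_tiltedRay φ θ).deriv] at hcross
    have : t = R θ * Real.cos φ := by
      simp only [planeCross, Complex.add_re, Complex.add_im, Complex.ofReal_re,
        Complex.ofReal_im, Complex.mul_re, Complex.mul_im, Complex.I_re, Complex.I_im,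
        unitTangent_re, unitTangent_im, tiltedRay_re, tiltedRay_im] at hcross
      have h1 := Real.sin_sq_add_cos_sq (θ - φ)
      have h2 : Real.cos φ = Real.cos θ * Real.cos (θ - φ) + Real.sin θ * Real.sin (θ - φ) := by
        rw [← Real.cos_sub]
        ring_nf
      rw [h2]
      linear_combination -hcross - t * h1
    rw [ht, this]
  have hRd : HasDerivAt (fun θ => ((R θ * Real.cos φ : ℝ) : ℂ))
      ((deriv R θ * Real.cos φ : ℝ) : ℂ) θ :=
    (((hr.1.differentiable (by simp) θ).hasDerivAt).mul_const _).ofReal_comp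
  have hcd' := (hrd θ).add (hRd.mul (hasDerivAt_tiltedRay φ θ))
  rw [hcr] at hcd
  have heq := hcd.unique hcd'
  have hθ : R₁ (θ + Real.pi / 2 - φ) = a * R (θ - α) := by
    rw [hsim, hα]
    ring_nf
  rw [hθ] at heq
  have hre := congrArg Complex.re heq
  have him := congrArg Complex.im heq
  simp only [Complex.add_re, Complex.add_im, Complex.ofReal_re,
    Complex.ofReal_im, Complex.mul_re, Complex.mul_im, Complex.I_re, Complex.I_im,
    unitTangent_re, unitTangent_im, tiltedRay_re, tiltedRay_im] at hre him
  have h1 := Real.sin_sq_add_cos_sq (θ - φ)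
  have h2 : Real.sin φ = Real.sin θ * Real.cos (θ - φ) - Real.cos θ * Real.sin (θ - φ) := by
    rw [← Real.sin_sub]
    ring_nf
  rw [h2]
  linear_combination Real.sin (θ - φ) * hre - Real.cos (θ - φ) * him +
    (a * R (θ - α) - Real.cos φ * deriv R θ) * h1

/-! ### Exponents of the delay equation, and the change of variables to the normalized one. -/

lemma lambertArg_ne_zero {φ a α : ℝ} (hφ : Real.cos φ ≠ 0) (ha : a ≠ 0) (hα : α ≠ 0) :
    lambertArg φ a α ≠ 0 :=
  mul_ne_zero (div_ne_zero (mul_ne_zero hα ha) hφ) (Real.exp_ne_zero _)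

lemma exists_eq_skewExponent_iff {φ a α : ℝ} (hφ : Real.cos φ ≠ 0) (ha : a ≠ 0) (hα : α ≠ 0)
    (μ : ℂ) : (∃ k : ℤ, μ = skewExponent φ a α k) ↔
      (Real.cos φ : ℂ) * μ + Real.sin φ = a * Complex.exp (-(μ * α)) := by
  have hw := lambertArg_ne_zero hφ ha hα
  have hαc : (α : ℂ) ≠ 0 := by exact_mod_cast hα
  have hφc : (Real.cos φ : ℂ) ≠ 0 := by exact_mod_cast hφ
  have h1 : (∃ k : ℤ, μ = skewExponent φ a α k) ↔
      -- The substitution `z = α (μ + tan φ)` inverts the formula for the exponents.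
      lambertChar (lambertArg φ a α) (α * (μ + Real.tan φ)) = 0 := by
    constructor
    · rintro ⟨k, rfl⟩
      have : (α : ℂ) * (skewExponent φ a α k + Real.tan φ) = lambertW k (lambertArg φ a α) := by
        unfold skewExponent
        field_simp
        ring
      rw [this]
      exact (lambertW_spec hw k).2
    · intro h
      obtain ⟨k, hk⟩ := exists_eq_lambertW hw h
      refine ⟨k, ?_⟩
      unfold skewExponent
      rw [hk]
      field_simp
      ring
  rw [h1, lambertChar_eq_zero_iff]
  have hexp : Complex.exp (α * (μ + Real.tan φ)) =
      Complex.exp (μ * α) * Complex.exp (α * Real.tan φ) := by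
    rw [← Complex.exp_add]
    ring_nf
  have htan : (Real.cos φ : ℂ) * Real.tan φ = Real.sin φ := by
    rw [← Complex.ofReal_mul, mul_comm, Real.tan_mul_cos hφ]
  have hw' : (lambertArg φ a α : ℂ) =
      α * a / Real.cos φ * Complex.exp (α * Real.tan φ) := by
    unfold lambertArg
    push_cast
    rfl
  rw [hexp, hw', Complex.exp_neg, ← div_eq_mul_inv, eq_div_iff (Complex.exp_ne_zero _), ← htan]
  have he := Complex.exp_ne_zero ((α : ℂ) * Real.tan φ)
  rw [← mul_assoc, mul_left_inj' he, eq_div_iff hφc]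
  constructor
  · intro h
    refine mul_left_cancel₀ hαc ?_
    linear_combination h
  · intro h
    linear_combination (α : ℂ) * h

lemma exp_solution_iff (φ a α : ℝ) (μ : ℂ) :
    (∀ θ : ℝ, (Real.cos φ : ℂ) * deriv (fun x : ℝ => Complex.exp (μ * (x : ℂ))) θ +
      (Real.sin φ : ℂ) * Complex.exp (μ * (θ : ℂ)) =
        (a : ℂ) * Complex.exp (μ * ((θ - α : ℝ) : ℂ))) ↔
      (Real.cos φ : ℂ) * μ + Real.sin φ = a * Complex.exp (-(μ * α)) := by
  have hexp : ∀ θ : ℝ, Complex.exp (μ * ((θ - α : ℝ) : ℂ)) =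
      Complex.exp (-(μ * α)) * Complex.exp (μ * θ) := by
    intro θ
    rw [← Complex.exp_add]
    push_cast
    ring_nf
  refine ⟨fun h => ?_, fun h θ => ?_⟩
  · have h0 := h 0
    rw [(hasDerivAt_exp_mul_ofReal μ 0).deriv, hexp] at h0
    simpa using h0
  · rw [(hasDerivAt_exp_mul_ofReal μ θ).deriv, hexp]
    linear_combination Complex.exp (μ * θ) * h

/-- The rescaled inclination equation solves the normalized delay equation. -/
lemma isDelaySolution_rescale {φ a α : ℝ} (hφ : Real.cos φ ≠ 0) {R : ℝ → ℝ} (hR : ContDiff ℝ ∞ R)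
    (hdde : ∀ θ : ℝ, Real.cos φ * deriv R θ + Real.sin φ * R θ = a * R (θ - α)) :
    IsDelaySolution (lambertArg φ a α)
      (fun s => ((Real.exp (Real.tan φ * (α * s)) * R (α * s) : ℝ) : ℂ)) := by
  have hsmul : ContDiff ℝ ∞ (fun s : ℝ => α * s) := contDiff_const.mul contDiff_id
  refine ⟨Complex.ofRealCLM.contDiff.comp
    ((contDiff_const.mul hsmul).exp.mul (hR.comp hsmul)), fun s => ?_⟩
  have h1 := (hasDerivAt_id s).const_mul α
  have h2 := (h1.const_mul (Real.tan φ)).exp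
  have h3 := (hR.differentiable (by simp) (α * s)).hasDerivAt.comp s h1
  refine (h2.mul h3).ofReal_comp.deriv.trans ?_
  have h4 := hdde (α * s)
  have h5 : Real.exp (Real.tan φ * (α * s)) =
      Real.exp (α * Real.tan φ) * Real.exp (Real.tan φ * (α * (s - 1))) := by
    rw [← Real.exp_add]
    ring_nf
  have h6 : Real.cos φ * Real.tan φ = Real.sin φ := by rw [mul_comm, Real.tan_mul_cos hφ]
  have h7 : α * s - α = α * (s - 1) := by ring
  rw [h7] at h4
  rw [← Complex.ofReal_mul]
  congr 1
  unfold lambertArg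
  simp only [id, Function.comp_apply]
  rw [h5]
  field_simp
  rw [← h6] at h4
  linear_combination α * h4

lemma skewExponent_re (φ a α : ℝ) (k : ℤ) :
    (skewExponent φ a α k).re = (lambertW k (lambertArg φ a α)).re / α - Real.tan φ := by
  unfold skewExponent
  rw [Complex.sub_re, Complex.div_ofReal_re, Complex.ofReal_re]

lemma skewExponent_im (φ a α : ℝ) (k : ℤ) :
    (skewExponent φ a α k).im = (lambertW k (lambertArg φ a α)).im / α := by
  unfold skewExponent
  rw [Complex.sub_im, Complex.div_ofReal_im, Complex.ofReal_im, sub_zero]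

lemma exp_skewExponent_re_mul (φ a α : ℝ) (k : ℤ) (θ : ℝ) :
    Real.exp ((skewExponent φ a α k).re * θ) =
      Real.exp (-(Real.tan φ * θ)) *
        Real.exp ((lambertW k (lambertArg φ a α)).re * (θ / α)) := by
  rw [skewExponent_re, ← Real.exp_add]
  ring_nf

lemma realMode_skewExponent (φ a α : ℝ) (k : ℤ) (A B θ : ℝ) :
    realMode (skewExponent φ a α k) A B θ =
      Real.exp (-(Real.tan φ * θ)) * realMode (lambertW k (lambertArg φ a α)) A B (θ / α) := by
  unfold realMode
  rw [exp_skewExponent_re_mul, skewExponent_im, div_mul_eq_mul_div, mul_div_assoc, mul_assoc]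

theorem mainTheorem5 (φ a α : ℝ) (hφ : Real.cos φ ≠ 0) (ha : a ≠ 0) (R : ℝ → ℝ)
    (hR : SimilarToSkewEvoluteWithDelay φ a α R) :
    -- the delay differential equation
    (∀ θ : ℝ, Real.cos φ * deriv R θ + Real.sin φ * R θ = a * R (θ - α)) ∧
    -- its exponential solutions are those with the exponents `λ_k`
    (∀ μ : ℂ,
      (∀ θ : ℝ, (Real.cos φ : ℂ) * deriv (fun x : ℝ => Complex.exp (μ * (x : ℂ))) θ +
          (Real.sin φ : ℂ) * Complex.exp (μ * (θ : ℂ)) =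
            (a : ℂ) * Complex.exp (μ * ((θ - α : ℝ) : ℂ))) ↔
        ∃ k : ℤ, μ = skewExponent φ a α k) ∧
    -- `R` is an absolutely convergent sum of real modes with these exponents
    (∃ (A B : ℕ → ℝ) (A' : ℝ),
      (A' ≠ 0 → (skewExponent φ a α (-1)).im = 0) ∧
      ∀ θ : ℝ, HasSum (fun k : ℕ => realMode (skewExponent φ a α (k : ℤ)) (A k) (B k) θ)
        (R θ - A' * secondRealMode φ a α θ)) := by
  have hα : α ≠ 0 := hR.1.ne'
  have hdde := delay_equation_of_similar hR
  refine ⟨hdde, fun μ => (exp_solution_iff φ a α μ).trans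
    (exists_eq_skewExponent_iff hφ ha hα μ).symm, ?_⟩
  have hsmooth : ContDiff ℝ ∞ R := by
    obtain ⟨-, r, c, R₁, β, hr, -⟩ := hR
    exact hr.1
  obtain ⟨A, B, A', hA', h⟩ := exists_real_expansion (lambertArg_ne_zero hφ ha hα)
    (isDelaySolution_rescale hφ hsmooth hdde)
  -- With `s = θ / α`, the factor `s` of the degenerate mode is `α⁻¹ θ`, whence the rescaled
  -- coefficient.
  refine ⟨A, B, A' * if lambertArg φ a α = -Real.exp (-1) then α⁻¹ else 1, fun hne => ?_,
    fun θ => ?_⟩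
  · rw [skewExponent_im, hA' (left_ne_zero_of_mul hne), zero_div]
  · have h1 := (h (θ / α)).mul_left (Real.exp (-(Real.tan φ * θ)))
    rw [mul_div_cancel₀ _ hα] at h1
    convert! h1.congr_fun fun k => realMode_skewExponent φ a α k _ _ θ using 1
    have h2 : Real.exp (-(Real.tan φ * θ)) * Real.exp (Real.tan φ * θ) = 1 := by
      rw [← Real.exp_add]
      simp
    unfold secondRealMode
    rw [exp_skewExponent_re_mul]
    split_ifs <;> linear_combination -R θ * h2
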